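/- Conventions. The Euclidean group $E(d)$ acts on $\mathbb R^d$ from the right (so $x(ab)=(xa)b$), $t_x\in E(d)$ is the translation $y\mapsto x+y$, and $O(d)\le E(d)$ is the orthogonal group. For $F\subseteq\mathbb R^d$ put $G(F)=\{a\in E(d)\mid Fa=F\}$, and let $cc(F)$ be the set of connected components of $F$. A partial group $\mathcal P$ consists of a set $\mathcal P_1$, sets $\mathcal P_n$ ($n\ge 1$) of words of length $n$ in $\mathcal P_1$, products $\triangledown_n:\mathcal P_n\to\mathcal P_1$, a unit and an inversion, subject to the usual axioms. A map of partial groups is a map $\phi:\mathcal P_1\to\mathcal Q_1$ that sends words in $\mathcal P_n$ letterwise to words in $\mathcal Q_n$ and is compatible with all $\triangledown_n$; it is an isomorphism if it is bijective and its inverse is also a map of partial groups. For non-empty $F$, the symmetry partial group $\mathcal P(F)$ has as words of length $n$ the sequences $(\pi_1,\dots,\pi_n)$ in $E(d)$ for which there is $C\in cc(F)$ with $C\pi_1,\ C\pi_1\pi_2,\dots,C\pi_1\cdots\pi_n\in cc(F)$; the product is that of $E(d)$. For non-empty $P\subseteq\mathbb R^d$, the partial group $\mathcal V(P)$ has as words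 of length $n$ the sequences $(p_1-p_0,\dots,p_n-p_{n-1})$ with $p_0,\dots,p_n\in P$; the product is the sum of vectors. For a group $G$, the wedge sum $\bigvee_P G$ has elements $[y,a]$ ($y\in P$, $a\in G$), where all $[y,1]$ are identified with the unit $1$ and there are no other identifications; its words are the $([y,a_1],\dots,[y,a_n])$ with a common $y\in P$, with product $[y,a_1\cdots a_n]$. The partial group $\mathcal V(P)$ acts on it: $([y,a_1],\dots,[y,a_r])$ can be acted upon by the word $(p_1-p_0,\dots,p_n-p_{n-1})$ when $y=p_0$, with result $([p_n,a_1],\dots,[p_n,a_r])$. We write $\lhd(\eta\mid\gamma)$ for the result of this action of $\gamma$ on $\eta$ (the empty word acts trivially). The elements of the semidirect product $\mathcal V(P)\ltimes\bigvee_P G$ are the pairs $v\ltimes\eta$ such that $-v$ is an element of $\mathcal V(P)_1$ that can act on $\eta$. Its words are the words $(v_1\ltimes\eta_1,\dots,v_n\ltimes\eta_n)$ in these elements such that $(v_{j+1},\dots,v_n)$ can act on $\eta_j$ for all $1\le j<n$, and such that $A=(\lhd(\eta_1\mid v_2,\dots,v_n),\dots,\lhd(\eta_{n-1}\mid v_n),\eta_n)$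 is a word of $\bigvee_P G$ on which $(-v_n,\dots,-v_1)$ can act. The product of such a word is $(v_1+\dots+v_n)\ltimes\triangledown_n(A)$. Let $F,F_0,P\subseteq\mathbb R^d$ with $F,P$ non-empty, $cc(F)=\{F_0+x\mid x\in P\}$ and $G(F_0)\subseteq O(d)$. Let $$\psi:\ \mathcal V(P)\ltimes\bigvee\nolimits_P G(F_0)\to\mathcal P(F),\qquad \psi(v\ltimes[y,a])=t_v\,t_y^{-1}\,a\,t_y$$ be the canonical map of partial groups. The figure $F$ is said to be of SDP (semidirect product) type if $\psi$ is an isomorphism of partial groups $\mathcal V(P)\ltimes\bigvee_P G(F_0)\cong\mathcal P(F)$. **Proposition 12.4.** (1) If $|P|\ge 2$ and $G(F)\not\subseteq\{t_x\mid x\in\mathbb R^d\}$, then $F$ is not of SDP type. (2) Suppose that for all $v,w\in\mathcal V(P)_1$, $|v|=|w|$ implies $v=\pm w$, and that for all $v\in\mathcal V(P)_1$ and $a\in G(F_0)$, $va=\pm v$ implies $v=0$ or $a=1$. Then $F$ is of SDP type. -/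

import Mathlib

namespace PartialSymmetry

/-- A partial group. Its elements live in an ambient type `α`; the set `𝒫ₙ` (`n ≥ 1`) consists of
the words of length `n` in `dom`, the underlying set `𝒫₁` is `carrier` below, and `mul` is the
family of products `▽ₙ : 𝒫ₙ → 𝒫₁` (its values off `dom` play no role). The axioms say: words are
closed under removing the first or the last letter; multiplying a non-empty block gives a word with
the same product; units may be inserted anywhere and are neutral; `π × π⁻¹` and `π⁻¹ × π` are words
for every word `π`, and `π π⁻¹ = 1 = π⁻¹ π` for every element `π`. -/
structure PartialGroup (α : Type*) where
  dom : Set (List α)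
  mul : List α → α
  one : α
  inv : α → α
  ne_nil : ∀ {w}, w ∈ dom → w ≠ []
  mul_singleton : ∀ {a}, [a] ∈ dom → mul [a] = a
  tail_mem : ∀ {a w}, a :: w ∈ dom → w ≠ [] → w ∈ dom
  init_mem : ∀ {a w}, w ++ [a] ∈ dom → w ≠ [] → w ∈ dom
  mul_mem : ∀ {u v w}, u ++ v ++ w ∈ dom → v ≠ [] → u ++ mul v :: w ∈ dom
  mul_mul : ∀ {u v w}, u ++ v ++ w ∈ dom → v ≠ [] → mul (u ++ mul v :: w) = mul (u ++ v ++ w)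
  one_mem : [one] ∈ dom
  insert_one_mem : ∀ {u v}, u ++ v ∈ dom → u ++ one :: v ∈ dom
  one_mul : ∀ {a}, [a] ∈ dom → mul [one, a] = a
  mul_one : ∀ {a}, [a] ∈ dom → mul [a, one] = a
  append_inv_mem : ∀ {w}, w ∈ dom → w ++ (w.map inv).reverse ∈ dom
  inv_append_mem : ∀ {w}, w ∈ dom → (w.map inv).reverse ++ w ∈ dom
  mul_inv : ∀ {a}, [a] ∈ dom → mul [a, inv a] = one
  inv_mul : ∀ {a}, [a] ∈ dom → mul [inv a, a] = one

namespace PartialGroup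

variable {α β : Type*} (P : PartialGroup α)

/-- The underlying set `𝒫₁`. -/
def carrier : Set α := {a | [a] ∈ P.dom}

/-- The inverse word `π⁻¹ = (πₙ⁻¹, …, π₁⁻¹)`. -/
def invWord (w : List α) : List α := (w.map P.inv).reverse

/-- `φ` restricts to a map of partial groups from `P` to `Q`. -/
def IsMap (P : PartialGroup α) (Q : PartialGroup β) (φ : α → β) : Prop :=
  ∀ w ∈ P.dom, w.map φ ∈ Q.dom ∧ Q.mul (w.map φ) = φ (P.mul w)

/-- `φ` restricts to an isomorphism of partial groups from `P` to `Q`: it is a map of partial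
groups that has a two-sided inverse `𝒬₁ → 𝒫₁` which is a map of partial groups as well. -/
def IsIso (P : PartialGroup α) (Q : PartialGroup β) (φ : α → β) : Prop :=
  P.IsMap Q φ ∧ ∃ χ : β → α, Q.IsMap P χ ∧
    (∀ a ∈ P.carrier, χ (φ a) = a) ∧ (∀ b ∈ Q.carrier, φ (χ b) = b)

variable {P}

theorem prefix_mem {u v : List α} (h : u ++ v ∈ P.dom) (hu : u ≠ []) : u ∈ P.dom := by
  induction v using List.reverseRecOn with
  | nil => simpa using h
  | append_singleton v a ih =>
    rw [← List.append_assoc] at h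
    exact ih (P.init_mem h (by simp [hu]))

theorem suffix_mem {u v : List α} (h : u ++ v ∈ P.dom) (hv : v ≠ []) : v ∈ P.dom := by
  induction u with
  | nil => simpa using h
  | cons a u ih => exact ih (P.tail_mem h (by simp [hv]))

theorem letter_mem {w : List α} (h : w ∈ P.dom) {a : α} (ha : a ∈ w) : [a] ∈ P.dom := by
  obtain ⟨u, v, rfl⟩ := List.append_of_mem ha
  exact prefix_mem (u := [a]) (v := v) (suffix_mem h (by simp)) (by simp)

theorem inv_mem {a : α} (h : [a] ∈ P.dom) : [P.inv a] ∈ P.dom :=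
  suffix_mem (u := [a]) (P.append_inv_mem h) (by simp)

theorem invWord_mem {w : List α} (h : w ∈ P.dom) : P.invWord w ∈ P.dom :=
  suffix_mem (P.append_inv_mem h) (by simpa [invWord] using P.ne_nil h)

theorem invWord_append (u v : List α) : P.invWord (u ++ v) = P.invWord v ++ P.invWord u := by
  simp [invWord]

theorem mul_insert_one {u v : List α} (h : u ++ v ∈ P.dom) :
    P.mul (u ++ P.one :: v) = P.mul (u ++ v) := by
  have h1 := P.insert_one_mem h
  rcases List.eq_nil_or_concat u with rfl | ⟨u', c, rfl⟩
  · cases v with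
    | nil => exact absurd rfl (P.ne_nil h)
    | cons b v =>
      have hb := letter_mem h (a := b) (by simp)
      have := P.mul_mul (u := []) (v := [P.one, b]) (w := v) (by simpa using h1) (by simp)
      rw [P.one_mul hb] at this
      simpa using this.symm
  · have hc := letter_mem h (a := c) (by simp)
    have := P.mul_mul (u := u') (v := [c, P.one]) (w := v) (by simpa using h1) (by simp)
    rw [P.mul_one hc] at this
    simpa using this.symm

theorem inv_unique {a b : α} (h : [a, b] ∈ P.dom) (e : P.mul [a, b] = P.one) : b = P.inv a := by
  have ha : [a] ∈ P.dom := letter_mem h (by simp)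
  have hb : [b] ∈ P.dom := letter_mem h (by simp)
  have h4 := P.inv_append_mem h
  have h3 : [P.inv a, a, b] ∈ P.dom :=
    suffix_mem (u := [P.inv b]) (by simpa using h4) (by simp)
  have e1 := P.mul_mul (u := []) (v := [P.inv a, a]) (w := [b]) (by simpa using h3) (by simp)
  have e2 := P.mul_mul (u := [P.inv a]) (v := [a, b]) (w := []) (by simpa using h3) (by simp)
  rw [P.inv_mul ha] at e1
  rw [e] at e2
  simp only [List.nil_append, List.cons_append, List.append_nil] at e1 e2
  rw [P.one_mul hb] at e1
  rw [P.mul_one (inv_mem ha)] at e2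
  exact e1.trans e2.symm

theorem inv_inv {a : α} (h : [a] ∈ P.dom) : P.inv (P.inv a) = a :=
  (inv_unique (by simpa using P.inv_append_mem h) (P.inv_mul h)).symm

theorem inv_one : P.inv P.one = P.one :=
  (inv_unique (by simpa using P.insert_one_mem (u := []) P.one_mem) (P.one_mul P.one_mem)).symm

theorem invWord_invWord {w : List α} (h : ∀ a ∈ w, [a] ∈ P.dom) :
    P.invWord (P.invWord w) = w := by
  simp only [invWord, List.map_reverse, List.reverse_reverse, List.map_map]
  conv_rhs => rw [← List.map_id w]
  exact List.map_congr_left fun a ha => by simpa using inv_inv (h a ha)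

theorem mul_append_invWord {w : List α} (h : w ∈ P.dom) : P.mul (w ++ P.invWord w) = P.one := by
  induction w using List.reverseRecOn with
  | nil => exact absurd rfl (P.ne_nil h)
  | append_singleton u a ih =>
    have ha : [a] ∈ P.dom := letter_mem h (by simp)
    have h1 := P.append_inv_mem h
    have h2 : u ++ [a, P.inv a] ++ P.invWord u ∈ P.dom := by simpa [invWord] using h1
    have e := P.mul_mul h2 (by simp)
    rw [P.mul_inv ha] at e
    have e' : P.mul (u ++ [a] ++ P.invWord (u ++ [a])) = P.mul (u ++ P.one :: P.invWord u) := by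
      rw [e]; simp [invWord]
    rw [e']
    by_cases hu : u = []
    · subst hu; simpa [invWord] using P.mul_singleton P.one_mem
    · have hu' := prefix_mem h hu
      have := mul_insert_one (P.append_inv_mem hu')
      exact this.trans (ih hu')

theorem mul_invWord {w : List α} (h : w ∈ P.dom) : P.mul (P.invWord w) = P.inv (P.mul w) := by
  have h1 : w ++ P.invWord w ∈ P.dom := P.append_inv_mem h
  have hw := P.ne_nil h
  have hw' := P.ne_nil (invWord_mem h)
  have h2 := P.mul_mem (u := []) (v := w) (w := P.invWord w) (by simpa using h1) hw
  have e2 := P.mul_mul (u := []) (v := w) (w := P.invWord w) (by simpa using h1) hw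
  have h3 := P.mul_mem (u := [P.mul w]) (v := P.invWord w) (w := []) (by simpa using h2) hw'
  have e3 := P.mul_mul (u := [P.mul w]) (v := P.invWord w) (w := []) (by simpa using h2) hw'
  refine inv_unique (by simpa using h3) ?_
  simp only [List.nil_append, List.append_nil, List.cons_append] at e2 e3
  rw [e3, e2, mul_append_invWord h]

end PartialGroup

/-- A (right) `F`-set structure on a non-empty subset `X` of an ambient type `ξ`: the pairs
`(x | π)` in `XFₙ` (`n ≥ 0`, with the convention `XF₀ = X`) are the `(x, π) ∈ dom` with `π` of
length `n`, and `act` is the family of maps `◁ₙ : XFₙ → X` (with the convention `◁₀ = id`). -/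
structure PSet {α ξ : Type*} (F : PartialGroup α) (X : Set ξ) where
  dom : Set (ξ × List α)
  act : ξ → List α → ξ
  nonempty : X.Nonempty
  nil_mem : ∀ {x}, (x, []) ∈ dom ↔ x ∈ X
  act_nil : ∀ {x}, x ∈ X → act x [] = x
  fst_mem : ∀ {x w}, (x, w) ∈ dom → x ∈ X
  snd_mem : ∀ {x w}, (x, w) ∈ dom → w ≠ [] → w ∈ F.dom
  act_mem : ∀ {x w}, (x, w) ∈ dom → act x w ∈ X
  init_mem : ∀ {x w a}, (x, w ++ [a]) ∈ dom → (x, w) ∈ dom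
  act_append_mem : ∀ {x u v}, (x, u ++ v) ∈ dom → (act x u, v) ∈ dom
  act_append : ∀ {x u v}, (x, u ++ v) ∈ dom → act (act x u) v = act x (u ++ v)
  mul_mem : ∀ {x u v w}, (x, u ++ v ++ w) ∈ dom → v ≠ [] → (x, u ++ F.mul v :: w) ∈ dom
  act_mul : ∀ {x u v w}, (x, u ++ v ++ w) ∈ dom → v ≠ [] →
    act x (u ++ F.mul v :: w) = act x (u ++ v ++ w)
  insert_one_mem : ∀ {x u v}, (x, u ++ v) ∈ dom → (x, u ++ F.one :: v) ∈ dom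
  act_one : ∀ {x}, x ∈ X → act x [F.one] = x
  append_inv_mem : ∀ {x w}, (x, w) ∈ dom → (x, w ++ F.invWord w) ∈ dom

namespace PSet

variable {α ξ : Type*} {F : PartialGroup α} {X : Set ξ} (S : PSet F X)

/-- `X` is a friendly `F`-set. -/
def Friendly : Prop := ∀ w ∈ F.dom, ∃ x, (x, w) ∈ S.dom

variable {S}

theorem prefix_mem {x : ξ} {u v : List α} (h : (x, u ++ v) ∈ S.dom) : (x, u) ∈ S.dom := by
  induction v using List.reverseRecOn with
  | nil => simpa using h
  | append_singleton v a ih =>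
    rw [← List.append_assoc] at h
    exact ih (S.init_mem h)

theorem act_inv_mem {x : ξ} {w : List α} (h : (x, w) ∈ S.dom) :
    (S.act x w, F.invWord w) ∈ S.dom :=
  S.act_append_mem (S.append_inv_mem h)

theorem act_act_inv {x : ξ} {w : List α} (h : (x, w) ∈ S.dom) :
    S.act (S.act x w) (F.invWord w) = x := by
  have hx := S.fst_mem h
  by_cases hw : w = []
  · subst hw; simp [PartialGroup.invWord, S.act_nil hx]
  · have h1 := S.append_inv_mem h
    rw [S.act_append h1]
    have := S.act_mul (u := []) (v := w ++ F.invWord w) (w := []) (by simpa using h1)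
      (by simp [hw])
    rw [PartialGroup.mul_append_invWord (S.snd_mem h hw)] at this
    simp only [List.nil_append, List.append_nil] at this
    rw [← this, S.act_one hx]

theorem act_insert_one {x : ξ} {u v : List α} (h : (x, u ++ v) ∈ S.dom) :
    S.act x (u ++ F.one :: v) = S.act x (u ++ v) := by
  have h1 := S.insert_one_mem h
  have hu := prefix_mem h
  have hx := S.act_mem hu
  have h2 : (S.act x u, [F.one] ++ v) ∈ S.dom := S.act_append_mem h1
  rw [← S.act_append h1, ← S.act_append h, ← List.singleton_append, ← S.act_append h2,
    S.act_one hx]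

end PSet

/-- An `F`-partial group structure on the partial group `H`. The field `words` collects the
`F`-sets `ℋᵣ` (`r ≥ 1`) into one `F`-set of words. An action by partial group maps acts letter by
letter, and `letter a γ` is the action of `γ` on the one-letter word `a`. The remaining axioms say
that removing the first or last letter, multiplying a block, inserting a unit, and
`η ↦ η × η⁻¹`, `η ↦ η⁻¹ × η` are maps of `F`-sets, and that every word of `F` acts on `1` and
fixes it. -/
structure FPartialGroup {α β : Type*} (F : PartialGroup α) (H : PartialGroup β) where
  words : PSet F H.dom
  letter : β → List α → β
  act_eq : ∀ {η γ}, (η, γ) ∈ words.dom → words.act η γ = η.map (letter · γ)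
  tail_mem : ∀ {a η γ}, (a :: η, γ) ∈ words.dom → η ≠ [] → (η, γ) ∈ words.dom
  init_mem : ∀ {a η γ}, (η ++ [a], γ) ∈ words.dom → η ≠ [] → (η, γ) ∈ words.dom
  mul_mem : ∀ {u v w γ}, (u ++ v ++ w, γ) ∈ words.dom → v ≠ [] →
    (u ++ H.mul v :: w, γ) ∈ words.dom
  letter_mul : ∀ {u v w γ}, (u ++ v ++ w, γ) ∈ words.dom → v ≠ [] →
    letter (H.mul v) γ = H.mul (v.map (letter · γ))
  insert_one_mem : ∀ {u v γ}, (u ++ v, γ) ∈ words.dom → (u ++ H.one :: v, γ) ∈ words.dom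
  one_mem : ∀ {γ}, γ ∈ F.dom → ([H.one], γ) ∈ words.dom
  letter_one : ∀ {γ}, γ ∈ F.dom → letter H.one γ = H.one
  append_inv_mem : ∀ {η γ}, (η, γ) ∈ words.dom → (η ++ H.invWord η, γ) ∈ words.dom
  inv_append_mem : ∀ {η γ}, (η, γ) ∈ words.dom → (H.invWord η ++ η, γ) ∈ words.dom
  letter_inv : ∀ {a γ}, ([a], γ) ∈ words.dom → letter (H.inv a) γ = H.inv (letter a γ)

namespace FPartialGroup

variable {α β : Type*} {F : PartialGroup α} {H : PartialGroup β} (K : FPartialGroup F H)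

/-- The word `A(α) = (◁(η₁ | γ₂, …, γₙ), …, ◁(ηₙ₋₁ | γₙ), ηₙ)` of a word
`α = (γ₁ ⋉ η₁, …, γₙ ⋉ ηₙ)`. -/
def twist : List (α × β) → List β
  | [] => []
  | a :: w => K.letter a.2 (w.map Prod.fst) :: twist w

/-- All `(ηⱼ | γⱼ₊₁, …, γₙ)` are in `ℋ₁ℱₙ₋ⱼ`, for a word `(γ₁ ⋉ η₁, …, γₙ ⋉ ηₙ)`. -/
def Comp (w : List (α × β)) : Prop :=
  ∀ u a v, w = u ++ a :: v → ([a.2], v.map Prod.fst) ∈ K.words.dom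

/-- The words of `F ⋉ H`: every letter `γ ⋉ η` is of the form `δ⁻¹ ⋉ η` with `(η | δ) ∈ ℋ₁ℱ₁`,
all `(ηⱼ | γⱼ₊₁, …, γₙ)` are in `ℋ₁ℱₙ₋ⱼ`, and
`A⁺(α) = (A(α) | γₙ⁻¹, …, γ₁⁻¹)` is in `ℋₙℱₙ`. -/
def semidirectDom : Set (List (α × β)) :=
  {w | w ≠ [] ∧
    (∀ a ∈ w, ∃ δ, a.1 = F.inv δ ∧ δ ∈ F.carrier ∧ ([a.2], [δ]) ∈ K.words.dom) ∧
    K.Comp w ∧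
    (K.twist w, F.invWord (w.map Prod.fst)) ∈ K.words.dom}

variable {K}

theorem prefix_mem {u v : List β} {γ : List α} (h : (u ++ v, γ) ∈ K.words.dom) (hu : u ≠ []) :
    (u, γ) ∈ K.words.dom := by
  induction v using List.reverseRecOn with
  | nil => simpa using h
  | append_singleton v a ih =>
    rw [← List.append_assoc] at h
    exact ih (K.init_mem h (by simp [hu]))

theorem suffix_mem {u v : List β} {γ : List α} (h : (u ++ v, γ) ∈ K.words.dom) (hv : v ≠ []) :
    (v, γ) ∈ K.words.dom := by
  induction u with
  | nil => simpa using h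
  | cons a u ih => exact ih (K.tail_mem h (by simp [hv]))

theorem single_mem {w : List β} {γ : List α} (h : (w, γ) ∈ K.words.dom) {a : β} (ha : a ∈ w) :
    ([a], γ) ∈ K.words.dom := by
  obtain ⟨u, v, rfl⟩ := List.append_of_mem ha
  exact prefix_mem (u := [a]) (v := v) (suffix_mem h (by simp)) (by simp)

theorem letter_mem {a : β} {γ : List α} (h : ([a], γ) ∈ K.words.dom) :
    [K.letter a γ] ∈ H.dom := by
  have := K.words.act_mem h
  rwa [K.act_eq h] at this

theorem letter_nil {a : β} (h : [a] ∈ H.dom) : K.letter a [] = a := by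
  have h1 := K.words.nil_mem.2 h
  have := K.act_eq h1
  rw [K.words.act_nil h] at this
  simpa using this.symm

theorem letter_append_mem {w : List β} {γ δ : List α} (h : (w, γ ++ δ) ∈ K.words.dom) :
    (w.map (K.letter · γ), δ) ∈ K.words.dom := by
  have := K.words.act_append_mem h
  rwa [K.act_eq (PSet.prefix_mem h)] at this

theorem map_letter_append {w : List β} {γ δ : List α} (h : (w, γ ++ δ) ∈ K.words.dom) :
    (w.map (K.letter · γ)).map (K.letter · δ) = w.map (K.letter · (γ ++ δ)) := by
  have e := K.words.act_append h
  have h1 := letter_append_mem h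
  rwa [K.act_eq h, K.act_eq (PSet.prefix_mem h), K.act_eq h1] at e

theorem letter_append {a : β} {γ δ : List α} (h : ([a], γ ++ δ) ∈ K.words.dom) :
    K.letter (K.letter a γ) δ = K.letter a (γ ++ δ) := by
  have e := K.words.act_append h
  have h1 := letter_append_mem h
  rw [K.act_eq h, K.act_eq (PSet.prefix_mem h), K.act_eq h1] at e
  simpa using e

theorem letter_act_inv_mem {w : List β} {γ : List α} (h : (w, γ) ∈ K.words.dom) :
    (w.map (K.letter · γ), F.invWord γ) ∈ K.words.dom := by
  have := PSet.act_inv_mem h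
  rwa [K.act_eq h] at this

theorem letter_act_inv {a : β} {γ : List α} (h : ([a], γ) ∈ K.words.dom) :
    K.letter (K.letter a γ) (F.invWord γ) = a := by
  have e := PSet.act_act_inv h
  have h1 := letter_act_inv_mem h
  rw [K.act_eq h, K.act_eq h1] at e
  simpa using e

theorem letter_mul_right {a : β} {u v w : List α} (h : ([a], u ++ v ++ w) ∈ K.words.dom)
    (hv : v ≠ []) : K.letter a (u ++ F.mul v :: w) = K.letter a (u ++ v ++ w) := by
  have e := K.words.act_mul h hv
  rw [K.act_eq h, K.act_eq (K.words.mul_mem h hv)] at e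
  simpa using e

theorem letter_insert_one {a : β} {u v : List α} (h : ([a], u ++ v) ∈ K.words.dom) :
    K.letter a (u ++ F.one :: v) = K.letter a (u ++ v) := by
  have e := PSet.act_insert_one h
  rw [K.act_eq h, K.act_eq (K.words.insert_one_mem h)] at e
  simpa using e

theorem twist_length (w : List (α × β)) : (K.twist w).length = w.length := by
  induction w with
  | nil => rfl
  | cons a w ih => simp [twist, ih]

theorem twist_ne_nil {w : List (α × β)} (h : w ≠ []) : K.twist w ≠ [] := by
  intro e
  have := twist_length (K := K) w
  rw [e] at this
  exact h (List.length_eq_zero_iff.1 this.symm)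

theorem Comp.nil : Comp K [] := by
  intro u a v h; simp at h

theorem Comp.cons_iff {a : α × β} {w : List (α × β)} :
    Comp K (a :: w) ↔ ([a.2], w.map Prod.fst) ∈ K.words.dom ∧ Comp K w := by
  constructor
  · intro h
    exact ⟨h [] a w rfl, fun u b v e => h (a :: u) b v (by simp [e])⟩
  · rintro ⟨h1, h2⟩ u b v e
    cases u with
    | nil =>
      simp only [List.nil_append, List.cons.injEq] at e
      obtain ⟨rfl, rfl⟩ := e
      exact h1
    | cons c u =>
      simp only [List.cons_append, List.cons.injEq] at e
      exact h2 u b v e.2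

theorem Comp.right {u v : List (α × β)} (h : Comp K (u ++ v)) : Comp K v := by
  induction u with
  | nil => exact h
  | cons a u ih => exact ih (Comp.cons_iff.1 h).2

theorem Comp.left {u v : List (α × β)} (h : Comp K (u ++ v)) : Comp K u := by
  intro s a t e
  have := h s a (t ++ v) (by simp [e])
  rw [List.map_append] at this
  exact PSet.prefix_mem this

theorem twist_append {u v : List (α × β)} (h : Comp K (u ++ v)) :
    K.twist (u ++ v) = (K.twist u).map (K.letter · (v.map Prod.fst)) ++ K.twist v := by
  induction u with
  | nil => rfl
  | cons a u ih =>
    rw [List.cons_append, Comp.cons_iff, List.map_append] at h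
    simp only [List.cons_append, twist, List.map_cons, List.map_append]
    rw [ih h.2, letter_append h.1]

/-- Acting on `A(u)` by `γ(v)` and then by its inverse does nothing. -/
theorem twist_back {u v : List (α × β)} (h : Comp K (u ++ v)) :
    ((K.twist u).map (K.letter · (v.map Prod.fst))).map
      (K.letter · (F.invWord (v.map Prod.fst))) = K.twist u := by
  induction u with
  | nil => rfl
  | cons a u ih =>
    rw [List.cons_append, Comp.cons_iff, List.map_append] at h
    simp only [twist, List.map_cons]
    rw [ih h.2]
    have := letter_append_mem h.1
    rw [letter_act_inv this]

theorem mem_dom_iff {w : List (α × β)} : w ∈ K.semidirectDom ↔ w ≠ [] ∧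
    (∀ a ∈ w, ∃ δ, a.1 = F.inv δ ∧ δ ∈ F.carrier ∧ ([a.2], [δ]) ∈ K.words.dom) ∧
    Comp K w ∧ (K.twist w, F.invWord (w.map Prod.fst)) ∈ K.words.dom := Iff.rfl

theorem fst_letter_mem {w : List (α × β)} (h : w ∈ K.semidirectDom) :
    ∀ a ∈ w.map Prod.fst, [a] ∈ F.dom := by
  intro a ha
  obtain ⟨b, hb, rfl⟩ := List.mem_map.1 ha
  obtain ⟨δ, e, hδ, -⟩ := h.2.1 b hb
  rw [e]
  exact PartialGroup.inv_mem hδ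

theorem fst_mem {w : List (α × β)} (h : w ∈ K.semidirectDom) : w.map Prod.fst ∈ F.dom := by
  have h1 := K.words.snd_mem h.2.2.2 (by simpa [PartialGroup.invWord] using h.1)
  have := PartialGroup.invWord_mem h1
  rwa [PartialGroup.invWord_invWord (fst_letter_mem h)] at this

theorem sd_tail {a : α × β} {w : List (α × β)} (h : a :: w ∈ K.semidirectDom) (hw : w ≠ []) :
    w ∈ K.semidirectDom := by
  rw [mem_dom_iff] at h ⊢
  obtain ⟨-, h1, h2, h3⟩ := h
  refine ⟨hw, fun b hb => h1 b (by simp [hb]), (Comp.cons_iff.1 h2).2, ?_⟩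
  have h4 := K.tail_mem h3 (twist_ne_nil hw)
  rw [List.map_cons, ← List.singleton_append, PartialGroup.invWord_append] at h4
  exact PSet.prefix_mem h4

theorem sd_prefix {u v : List (α × β)} (h : u ++ v ∈ K.semidirectDom) (hu : u ≠ []) :
    u ∈ K.semidirectDom := by
  rw [mem_dom_iff] at h ⊢
  obtain ⟨-, h1, h2, h3⟩ := h
  refine ⟨hu, fun b hb => h1 b (by simp [hb]), h2.left, ?_⟩
  rw [twist_append h2, List.map_append, PartialGroup.invWord_append] at h3
  have h4 := prefix_mem h3 (by simpa using twist_ne_nil (K := K) hu)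
  have h5 := letter_append_mem h4
  rwa [twist_back h2] at h5

theorem sd_suffix {u v : List (α × β)} (h : u ++ v ∈ K.semidirectDom) (hv : v ≠ []) :
    v ∈ K.semidirectDom := by
  induction u with
  | nil => exact h
  | cons a u ih => exact ih (sd_tail h (by simp [hv]))

theorem snd_mem {w : List (α × β)} (h : w ∈ K.semidirectDom) : K.twist w ∈ H.dom :=
  K.words.fst_mem h.2.2.2

/-- The product of `F ⋉ H`. -/
def sdMul (K : FPartialGroup F H) (w : List (α × β)) : α × β :=
  (F.mul (w.map Prod.fst), H.mul (K.twist w))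

theorem sd_letter {w : List (α × β)} (h : w ∈ K.semidirectDom) :
    ∃ δ, (sdMul K w).1 = F.inv δ ∧ δ ∈ F.carrier ∧ ([(sdMul K w).2], [δ]) ∈ K.words.dom := by
  have hF := fst_mem h
  have hF' := PartialGroup.invWord_mem hF
  have hne := PartialGroup.ne_nil _ hF'
  have h1 := h.2.2.2
  have h2 := K.mul_mem (u := []) (w := []) (by simpa using h1) (twist_ne_nil h.1)
  have h3 := K.words.mul_mem (u := []) (w := []) (by simpa using h2) hne
  have h4 := F.mul_mem (u := []) (w := []) (by simpa using hF') hne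
  refine ⟨F.mul (F.invWord (w.map Prod.fst)), ?_, by simpa [PartialGroup.carrier] using h4,
    by simpa [sdMul] using h3⟩
  have := PartialGroup.mul_invWord hF'
  rwa [PartialGroup.invWord_invWord (fst_letter_mem h)] at this

theorem sd_mul_comp {u v w : List (α × β)} (h : u ++ v ++ w ∈ K.semidirectDom) (hv : v ≠ []) :
    Comp K (u ++ sdMul K v :: w) ∧ K.twist (u ++ sdMul K v :: w) =
      (K.twist u).map (K.letter · ((v ++ w).map Prod.fst)) ++
        H.mul ((K.twist v).map (K.letter · (w.map Prod.fst))) :: K.twist w := by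
  have hc := h.2.2.1
  have hvw : v ++ w ∈ K.semidirectDom := sd_suffix (u := u) (by simpa using h) (by simp [hv])
  have hvw' := hvw.2.2.2
  have hcvw : Comp K (v ++ w) := hvw.2.2.1
  rw [twist_append hcvw, List.map_append, PartialGroup.invWord_append] at hvw'
  have h1 := PSet.prefix_mem (prefix_mem hvw' (by simpa using twist_ne_nil (K := K) hv))
  have h2 := letter_act_inv_mem h1
  have hl : ∀ a ∈ w.map Prod.fst, [a] ∈ F.dom := fun a ha =>
    fst_letter_mem h a (by simp only [List.map_append, List.mem_append]; exact Or.inr ha)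
  rw [twist_back hcvw, PartialGroup.invWord_invWord hl] at h2
  have h3 : ([H.mul (K.twist v)], w.map Prod.fst) ∈ K.words.dom := by
    simpa using K.mul_mem (u := []) (w := []) (by simpa using h2) (twist_ne_nil hv)
  have e3 := K.letter_mul (u := []) (w := []) (by simpa using h2) (twist_ne_nil hv)
  induction u with
  | nil =>
    refine ⟨Comp.cons_iff.2 ⟨h3, hcvw.right⟩, ?_⟩
    simp only [List.nil_append, twist, sdMul, List.map_nil]
    rw [e3]
  | cons a u ih =>
    have hc' : Comp K (a :: (u ++ v ++ w)) := by simpa using hc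
    rw [Comp.cons_iff] at hc'
    obtain ⟨i1, i2⟩ := ih (sd_tail (a := a) (by simpa using h) (by simp [hv])) hc'.2
    have ha := hc'.1
    simp only [List.map_append] at ha
    have hv' : v.map Prod.fst ≠ [] := by simpa using hv
    refine ⟨Comp.cons_iff.2 ⟨?_, i1⟩, ?_⟩
    · simpa [sdMul] using K.words.mul_mem ha hv'
    · simp only [List.cons_append, twist, List.map_cons, i2]
      congr 1
      have e1 := letter_mul_right ha hv'
      rw [List.append_assoc] at ha
      rw [List.map_append (l₁ := v), letter_append ha]
      simpa [sdMul, List.append_assoc] using e1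

theorem sd_mul_mem {u v w : List (α × β)} (h : u ++ v ++ w ∈ K.semidirectDom) (hv : v ≠ []) :
    u ++ sdMul K v :: w ∈ K.semidirectDom := by
  obtain ⟨c, e⟩ := sd_mul_comp h hv
  have hvd : v ∈ K.semidirectDom := sd_prefix (sd_suffix (u := u) (by simpa using h)
    (by simp [hv])) hv
  refine mem_dom_iff.2 ⟨by simp, ?_, c, ?_⟩
  · intro a ha
    simp only [List.mem_append, List.mem_cons] at ha
    rcases ha with ha | rfl | ha
    · exact h.2.1 a (by simp [ha])
    · exact sd_letter hvd
    · exact h.2.1 a (by simp [ha])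
  · have h1 := h.2.2.2
    have hc := h.2.2.1
    rw [List.append_assoc] at h1 hc
    rw [twist_append hc, twist_append (Comp.right hc), ← List.append_assoc] at h1
    have h2 := K.mul_mem h1 (by simpa using twist_ne_nil (K := K) hv)
    rw [e]
    simp only [List.map_append, PartialGroup.invWord_append] at h2
    have h3 := K.words.mul_mem (v := F.invWord (v.map Prod.fst)) h2
      (by simpa [PartialGroup.invWord] using hv)
    rw [PartialGroup.mul_invWord (fst_mem hvd)] at h3
    simpa [PartialGroup.invWord, sdMul] using h3

theorem sd_mul_mul {u v w : List (α × β)} (h : u ++ v ++ w ∈ K.semidirectDom) (hv : v ≠ []) :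
    sdMul K (u ++ sdMul K v :: w) = sdMul K (u ++ v ++ w) := by
  obtain ⟨c, e⟩ := sd_mul_comp h hv
  have hF := fst_mem h
  have hH := snd_mem h
  have hc := h.2.2.1
  rw [List.append_assoc] at hc hH
  rw [twist_append hc, twist_append (Comp.right hc), ← List.append_assoc] at hH
  have h2 : H.mul (K.twist (u ++ sdMul K v :: w)) = H.mul (K.twist (u ++ v ++ w)) := by
    rw [e, H.mul_mul hH (by simpa using twist_ne_nil (K := K) hv), List.append_assoc,
      List.append_assoc, twist_append hc, twist_append (Comp.right hc)]
  simp only [List.map_append] at hF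
  have h1 := F.mul_mul hF (by simpa using hv)
  rw [sdMul, h2, sdMul]
  congr 1
  simp only [List.map_append, List.map_cons]
  exact h1

theorem sd_one_comp {u v : List (α × β)} (hc : Comp K (u ++ v))
    (hv : v ≠ [] → v.map Prod.fst ∈ F.dom) :
    Comp K (u ++ (F.one, H.one) :: v) ∧ K.twist (u ++ (F.one, H.one) :: v) =
      (K.twist u).map (K.letter · (v.map Prod.fst)) ++ H.one :: K.twist v := by
  induction u with
  | nil =>
    by_cases hv' : v = []
    · subst hv'
      refine ⟨Comp.cons_iff.2 ⟨K.words.nil_mem.2 H.one_mem, Comp.nil⟩, ?_⟩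
      simp [twist, letter_nil H.one_mem]
    · refine ⟨Comp.cons_iff.2 ⟨K.one_mem (hv hv'), hc⟩, ?_⟩
      simp [twist, K.letter_one (hv hv')]
  | cons a u ih =>
    rw [List.cons_append, Comp.cons_iff] at hc
    obtain ⟨i1, i2⟩ := ih hc.2
    have ha := hc.1
    rw [List.map_append] at ha
    refine ⟨Comp.cons_iff.2 ⟨?_, i1⟩, ?_⟩
    · simpa using K.words.insert_one_mem ha
    · simp only [List.cons_append, twist, List.map_cons, i2]
      congr 1
      rw [letter_append ha]
      simpa using letter_insert_one ha

theorem sd_insert_one {u v : List (α × β)} (h : u ++ v ∈ K.semidirectDom) :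
    u ++ (F.one, H.one) :: v ∈ K.semidirectDom := by
  obtain ⟨c, e⟩ := sd_one_comp h.2.2.1 fun hv => fst_mem (sd_suffix h hv)
  refine mem_dom_iff.2 ⟨by simp, ?_, c, ?_⟩
  · intro a ha
    simp only [List.mem_append, List.mem_cons] at ha
    rcases ha with ha | rfl | ha
    · exact h.2.1 a (by simp [ha])
    · exact ⟨F.one, PartialGroup.inv_one.symm, F.one_mem, K.one_mem F.one_mem⟩
    · exact h.2.1 a (by simp [ha])
  · have h1 := h.2.2.2
    rw [twist_append h.2.2.1] at h1
    have h2 := K.insert_one_mem h1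
    rw [e]
    simp only [List.map_append, PartialGroup.invWord_append] at h2
    have h3 := K.words.insert_one_mem h2
    simpa [PartialGroup.invWord, PartialGroup.inv_one] using h3

theorem sd_one_mem : [(F.one, H.one)] ∈ K.semidirectDom := by
  have h1 := K.one_mem F.one_mem
  refine mem_dom_iff.2 ⟨by simp, ?_, Comp.cons_iff.2 ⟨K.words.nil_mem.2 H.one_mem, Comp.nil⟩, ?_⟩
  · intro a ha
    rw [List.mem_singleton] at ha
    subst ha
    exact ⟨F.one, PartialGroup.inv_one.symm, F.one_mem, h1⟩
  · simpa [twist, letter_nil H.one_mem, PartialGroup.invWord, PartialGroup.inv_one] using h1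

/-- The inverse of `F ⋉ H`: `(γ ⋉ η)⁻¹ = γ⁻¹ ⋉ ◁(η | γ⁻¹)⁻¹`. -/
def sdInv (K : FPartialGroup F H) (a : α × β) : α × β :=
  (F.inv a.1, H.inv (K.letter a.2 [F.inv a.1]))

/-- The inverse word. -/
def sdInvWord (K : FPartialGroup F H) (w : List (α × β)) : List (α × β) :=
  (w.map (sdInv K)).reverse

theorem sdInvWord_fst (w : List (α × β)) :
    (sdInvWord K w).map Prod.fst = F.invWord (w.map Prod.fst) := by
  simp [sdInvWord, PartialGroup.invWord, sdInv, Function.comp_def]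

theorem sd_letter_inv {a : α × β} (h : ∃ δ, a.1 = F.inv δ ∧ δ ∈ F.carrier ∧
      ([a.2], [δ]) ∈ K.words.dom) :
    ([a.2], [F.inv a.1]) ∈ K.words.dom ∧ [a.1] ∈ F.dom := by
  obtain ⟨δ, e, h1, h2⟩ := h
  rw [e, PartialGroup.inv_inv h1]
  exact ⟨h2, PartialGroup.inv_mem h1⟩

/-- The letters `ηᵢ` can be acted upon by `γᵢ⁻¹, …, γ₁⁻¹`. -/
theorem sd_back_mem {u : List (α × β)} {a : α × β} {v : List (α × β)}
    (h : u ++ a :: v ∈ K.semidirectDom) :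
    ([a.2], F.inv a.1 :: F.invWord (u.map Prod.fst)) ∈ K.words.dom := by
  have h' : (u ++ [a]) ++ v ∈ K.semidirectDom := by simpa using h
  have h1 := (sd_prefix h' (by simp)).2.2
  rw [twist_append h1.1] at h1
  have h2 := suffix_mem h1.2 (by simp [twist])
  have ha : [a.2] ∈ H.dom := K.words.fst_mem (h.2.2.1 u a v rfl)
  simpa [twist, PartialGroup.invWord, letter_nil ha] using h2

theorem sd_inv_twist {u v : List (α × β)} (h : u ++ v ∈ K.semidirectDom) :
    Comp K (sdInvWord K u) ∧ K.twist (sdInvWord K u) =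
      H.invWord ((K.twist u).map (K.letter · (F.invWord (u.map Prod.fst)))) := by
  induction u using List.reverseRecOn generalizing v with
  | nil => exact ⟨Comp.nil, rfl⟩
  | append_singleton u a ih =>
    have h' : u ++ a :: v ∈ K.semidirectDom := by simpa using h
    obtain ⟨i1, i2⟩ := ih h'
    have ew : sdInvWord K (u ++ [a]) = sdInv K a :: sdInvWord K u := by simp [sdInvWord]
    have hb := sd_back_mem h'
    have hb2 : ([K.letter a.2 [F.inv a.1]], F.invWord (u.map Prod.fst)) ∈ K.words.dom :=
      letter_append_mem (γ := [F.inv a.1]) hb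
    have hb3 : ([H.inv (K.letter a.2 [F.inv a.1])], F.invWord (u.map Prod.fst)) ∈ K.words.dom :=
      suffix_mem (K.append_inv_mem hb2) (by simp)
    have ha : [a.2] ∈ H.dom := K.words.fst_mem (h'.2.2.1 u a v rfl)
    have hua := h'.2.2.1
    have hua' : Comp K (u ++ [a]) := (show Comp K ((u ++ [a]) ++ v) by simpa using hua).left
    rw [ew]
    refine ⟨Comp.cons_iff.2 ⟨by rw [sdInvWord_fst]; exact hb3, i1⟩, ?_⟩
    rw [twist_append hua']
    simp only [twist, sdInvWord_fst, i2, sdInv]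
    have hY := (sd_prefix h (by simp)).2.2.2
    rw [twist_append hua', List.map_append, PartialGroup.invWord_append] at hY
    have eT : ((K.twist u).map (K.letter · ([a].map Prod.fst))).map (K.letter · (F.invWord
        ([a].map Prod.fst) ++ F.invWord (u.map Prod.fst))) =
          (K.twist u).map (K.letter · (F.invWord (u.map Prod.fst))) := by
      by_cases hu : u = []
      · subst hu; rfl
      · have hY1 := prefix_mem hY (by simpa using twist_ne_nil (K := K) hu)
        rw [← map_letter_append hY1, twist_back hua']
    rw [List.map_append (l₁ := u), PartialGroup.invWord_append (u.map Prod.fst), List.map_append,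
      eT, PartialGroup.invWord_append, K.letter_inv hb2, (letter_append (γ := [F.inv a.1]) hb :
        K.letter (K.letter a.2 [F.inv a.1]) (F.invWord (u.map Prod.fst)) = _)]
    simp [PartialGroup.invWord, letter_nil ha]

theorem sd_inv_twist_self {w : List (α × β)} (h : w ∈ K.semidirectDom) :
    Comp K (sdInvWord K w) ∧ K.twist (sdInvWord K w) =
      H.invWord ((K.twist w).map (K.letter · (F.invWord (w.map Prod.fst)))) :=
  sd_inv_twist (v := []) (by simpa using h)

theorem Comp.append {u v : List (α × β)} (hu : ∀ s a t, u = s ++ a :: t →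
    ([a.2], t.map Prod.fst ++ v.map Prod.fst) ∈ K.words.dom) (hv : Comp K v) :
    Comp K (u ++ v) := by
  induction u with
  | nil => exact hv
  | cons a u ih =>
    have := hu [] a u rfl
    rw [← List.map_append] at this
    exact Comp.cons_iff.2 ⟨this, ih fun s b t e => hu (a :: s) b t (by simp [e])⟩

theorem sd_inv_letters {w : List (α × β)} (h : w ∈ K.semidirectDom) :
    ∀ a ∈ sdInvWord K w, ∃ δ, a.1 = F.inv δ ∧ δ ∈ F.carrier ∧ ([a.2], [δ]) ∈ K.words.dom := by
  intro a ha
  simp only [sdInvWord, List.mem_reverse, List.mem_map] at ha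
  obtain ⟨b, hb, rfl⟩ := ha
  obtain ⟨h1, h2⟩ := sd_letter_inv (h.2.1 b hb)
  have h3 := letter_act_inv_mem h1
  have e : F.invWord [F.inv b.1] = [b.1] := by
    simp [PartialGroup.invWord, PartialGroup.inv_inv h2]
  rw [e] at h3
  exact ⟨b.1, rfl, h2, suffix_mem (K.append_inv_mem h3) (by simp)⟩

theorem map_act_inv {w : List β} {γ : List α} (h : (w, γ) ∈ K.words.dom) :
    (w.map (K.letter · γ)).map (K.letter · (F.invWord γ)) = w := by
  have e := PSet.act_act_inv h
  have h1 := letter_act_inv_mem h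
  rwa [K.act_eq h, K.act_eq h1] at e

theorem letter_mem_twist {s t : List (α × β)} {a : α × β} (h : Comp K (s ++ a :: t)) :
    K.letter a.2 (t.map Prod.fst) ∈ K.twist (s ++ a :: t) := by
  rw [twist_append h]
  simp [twist]

theorem sd_append_inv {w : List (α × β)} (h : w ∈ K.semidirectDom) :
    w ++ sdInvWord K w ∈ K.semidirectDom := by
  obtain ⟨c, e⟩ := sd_inv_twist_self h
  have hl := fst_letter_mem h
  have h0 := h.2.2.2
  have hY := letter_act_inv_mem h0
  have hYY := K.words.append_inv_mem (K.append_inv_mem hY)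
  have eF : F.invWord ((w ++ sdInvWord K w).map Prod.fst) =
      w.map Prod.fst ++ F.invWord (w.map Prod.fst) := by
    rw [List.map_append, sdInvWord_fst, PartialGroup.invWord_append,
      PartialGroup.invWord_invWord hl]
  have hc : Comp K (w ++ sdInvWord K w) := by
    refine Comp.append (fun s a t ew => ?_) c
    subst ew
    have hy := single_mem h0 (letter_mem_twist h.2.2.1)
    have hat := h.2.2.1 s a t rfl
    have hyy := single_mem hYY (List.mem_append_left _ (List.mem_map_of_mem
      (letter_mem_twist h.2.2.1)))
    rw [PartialGroup.invWord_invWord hl] at hyy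
    have e1 : F.invWord ((s ++ a :: t).map Prod.fst) =
        F.invWord (t.map Prod.fst) ++ F.invWord ((s ++ [a]).map Prod.fst) := by
      simp [PartialGroup.invWord]
    have hl' : ∀ b ∈ (s ++ [a]).map Prod.fst, [b] ∈ F.dom := fun b hb => hl b (by
      simp only [List.map_append, List.mem_append, List.map_cons, List.mem_cons] at hb ⊢
      rcases hb with hb | hb | hb
      · exact Or.inl hb
      · exact Or.inr (Or.inl hb)
      · simp at hb)
    rw [e1] at hy
    have e2 := letter_append hy
    rw [letter_act_inv hat] at e2
    have hy' := letter_append_mem hy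
    simp only [List.map_cons, List.map_nil, letter_act_inv hat] at hy'
    have e3 := letter_act_inv hy'
    rw [PartialGroup.invWord_invWord hl'] at e3
    have e4 : (s ++ a :: t).map Prod.fst = (s ++ [a]).map Prod.fst ++ t.map Prod.fst := by simp
    rw [e1, ← e2, e4, List.append_assoc] at hyy
    have := letter_append_mem hyy
    simp only [List.map_cons, List.map_nil, e3] at this
    rw [sdInvWord_fst, e1]
    exact this
  refine mem_dom_iff.2 ⟨by simp [h.1], ?_, hc, ?_⟩
  · intro a ha
    rcases List.mem_append.1 ha with ha | ha
    · exact h.2.1 a ha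
    · exact sd_inv_letters h a ha
  · rw [twist_append hc, eF, e, sdInvWord_fst]
    rwa [PartialGroup.invWord_invWord hl] at hYY

theorem sd_inv_append {w : List (α × β)} (h : w ∈ K.semidirectDom) :
    sdInvWord K w ++ w ∈ K.semidirectDom := by
  obtain ⟨c, e⟩ := sd_inv_twist_self h
  have hl := fst_letter_mem h
  have h0 := h.2.2.2
  have hYY := K.words.append_inv_mem (K.inv_append_mem h0)
  rw [PartialGroup.invWord_invWord hl] at hYY
  have hw := fst_mem h
  have hc : Comp K (sdInvWord K w ++ w) := by
    refine Comp.append (fun s' c t' ew => ?_) h.2.2.1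
    have ew' : w.map (sdInv K) = t'.reverse ++ c :: s'.reverse := by
      have := congrArg List.reverse ew
      simpa [sdInvWord] using this
    obtain ⟨s, r, rfl, es, er⟩ := List.map_eq_append_iff.1 ew'
    obtain ⟨a, t, rfl, rfl, et⟩ := List.map_eq_cons_iff.1 er
    have et' : t'.map Prod.fst = F.invWord (s.map Prod.fst) := by
      rw [← sdInvWord_fst (K := K), sdInvWord, es, List.reverse_reverse]
    have hat := h.2.2.1 s a t rfl
    have hy := single_mem hYY (List.mem_append_right _ (letter_mem_twist h.2.2.1))
    have e1 : F.invWord ((s ++ a :: t).map Prod.fst) =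
        F.invWord (t.map Prod.fst) ++ ([F.inv a.1] ++ F.invWord (s.map Prod.fst)) := by
      simp [PartialGroup.invWord]
    rw [e1, List.append_assoc, List.append_assoc] at hy
    have hy1 := letter_append_mem hy
    simp only [List.map_cons, List.map_nil, letter_act_inv hat] at hy1
    have hy2 := letter_append_mem hy1
    rw [et']
    exact suffix_mem (K.append_inv_mem hy2) (by simp)
  have e2 : (K.twist (sdInvWord K w)).map (K.letter · (w.map Prod.fst)) =
      H.invWord (K.twist w) := by
    have h1 := letter_act_inv_mem h0
    have e3 := map_act_inv h0
    rw [PartialGroup.invWord_invWord hl] at h1 e3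
    rw [e]
    conv_rhs => rw [← e3]
    simp only [PartialGroup.invWord, List.map_reverse, List.map_map]
    congr 1
    apply List.map_congr_left
    intro x hx
    have hx' := single_mem h1 (List.mem_map_of_mem hx)
    simpa [PartialGroup.invWord] using K.letter_inv hx'
  refine mem_dom_iff.2 ⟨by simp [h.1], ?_, hc, ?_⟩
  · intro a ha
    rcases List.mem_append.1 ha with ha | ha
    · exact sd_inv_letters h a ha
    · exact h.2.1 a ha
  · rw [twist_append hc, e2, List.map_append, PartialGroup.invWord_append, sdInvWord_fst,
      PartialGroup.invWord_invWord hl]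
    exact hYY

theorem sd_single {a : α × β} (h : [a] ∈ K.semidirectDom) :
    [a.1] ∈ F.dom ∧ [a.2] ∈ H.dom ∧ sdMul K [a] = a := by
  have h1 : [a.1] ∈ F.dom := fst_mem h
  have h2 : [a.2] ∈ H.dom := K.words.fst_mem (h.2.2.1 [] a [] rfl)
  refine ⟨h1, h2, ?_⟩
  simp [sdMul, twist, letter_nil h2, F.mul_singleton h1, H.mul_singleton h2]

variable (K) in
/-- The semidirect product `F ⋉ H` of `H` by `F`; its elements are pairs `γ ⋉ η = (γ, η)`. -/
def semidirect : PartialGroup (α × β) where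
  dom := K.semidirectDom
  mul w := (F.mul (w.map Prod.fst), H.mul (K.twist w))
  one := (F.one, H.one)
  inv a := (F.inv a.1, H.inv (K.letter a.2 [F.inv a.1]))
  ne_nil h := h.1
  mul_singleton h := (sd_single h).2.2
  tail_mem h hw := sd_tail h hw
  init_mem h hw := sd_prefix h hw
  mul_mem h hv := sd_mul_mem h hv
  mul_mul h hv := sd_mul_mul h hv
  one_mem := sd_one_mem
  insert_one_mem h := sd_insert_one h
  one_mul {a} h := by
    obtain ⟨h1, h2, -⟩ := sd_single h
    simp [twist, letter_nil h2, K.letter_one h1, F.one_mul h1, H.one_mul h2]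
  mul_one {a} h := by
    obtain ⟨h1, h2, -⟩ := sd_single h
    have h3 : ([a.2], [] ++ []) ∈ K.words.dom := K.words.nil_mem.2 h2
    have e := letter_insert_one h3
    simp only [List.nil_append, letter_nil h2] at e
    simp [twist, letter_nil H.one_mem, e, F.mul_one h1, H.mul_one h2]
  append_inv_mem h := sd_append_inv h
  inv_append_mem h := sd_inv_append h
  mul_inv {a} h := by
    obtain ⟨h1, h2, -⟩ := sd_single h
    obtain ⟨h3, -⟩ := sd_letter_inv (h.2.1 a (by simp))
    have h4 := letter_mem h3
    simp [twist, letter_nil (PartialGroup.inv_mem h4), F.mul_inv h1, H.mul_inv h4]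
  inv_mul {a} h := by
    obtain ⟨h1, h2, -⟩ := sd_single h
    obtain ⟨h3, -⟩ := sd_letter_inv (h.2.1 a (by simp))
    have h4 := letter_act_inv_mem h3
    have e := letter_act_inv h3
    have e1 : F.invWord [F.inv a.1] = [a.1] := by
      simp [PartialGroup.invWord, PartialGroup.inv_inv h1]
    rw [e1] at h4 e
    simp only [List.map_cons, List.map_nil] at h4
    simp [twist, letter_nil h2, F.inv_mul h1, K.letter_inv h4, e, H.inv_mul h2]

end FPartialGroup

/-- A right action of a group. -/
structure RightAction (G X : Type*) [Group G] where
  act : X → G → X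
  act_one : ∀ x, act x 1 = x
  act_mul : ∀ x a b, act x (a * b) = act (act x a) b

section Parades

variable {G X : Type*}

/-- All points `x, x π₁, x π₁ π₂, …, x π₁ ⋯ πₙ` lie in `S`. -/
def IsRoute (step : X → G → X) (S : Set X) : X → List G → Prop
  | x, [] => x ∈ S
  | x, a :: w => x ∈ S ∧ IsRoute step S (step x a) w

theorem IsRoute.start {step : X → G → X} {S : Set X} {x : X} {w : List G}
    (h : IsRoute step S x w) : x ∈ S := by
  cases w with
  | nil => exact h
  | cons a w => exact h.1

theorem isRoute_append {step : X → G → X} {S : Set X} {x : X} {u v : List G} :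
    IsRoute step S x (u ++ v) ↔ IsRoute step S x u ∧ IsRoute step S (u.foldl step x) v := by
  induction u generalizing x with
  | nil => exact ⟨fun h => ⟨h.start, h⟩, fun h => h.2⟩
  | cons a u ih => simp only [List.cons_append, IsRoute, List.foldl_cons, ih, and_assoc]

variable [Group G] (ρ : RightAction G X) (S : Set X)

theorem RightAction.foldl_act (x : X) (w : List G) : w.foldl ρ.act x = ρ.act x w.prod := by
  induction w generalizing x with
  | nil => simp [ρ.act_one]
  | cons a w ih => rw [List.foldl_cons, ih, List.prod_cons, ρ.act_mul]

variable {ρ S}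

theorem IsRoute.end_mem {x : X} {w : List G} (h : IsRoute ρ.act S x w) :
    ρ.act x w.prod ∈ S := by
  have h1 : IsRoute ρ.act S x (w ++ []) := by simpa using h
  rw [isRoute_append, ρ.foldl_act] at h1
  exact h1.2

theorem IsRoute.mul {x : X} {u v w : List G} (h : IsRoute ρ.act S x (u ++ v ++ w)) :
    IsRoute ρ.act S x (u ++ v.prod :: w) := by
  rw [List.append_assoc, isRoute_append, isRoute_append] at h
  rw [isRoute_append]
  refine ⟨h.1, h.2.1.start, ?_⟩
  simpa [ρ.foldl_act] using h.2.2

theorem IsRoute.insert_one {x : X} {u v : List G} (h : IsRoute ρ.act S x (u ++ v)) :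
    IsRoute ρ.act S x (u ++ 1 :: v) := by
  rw [isRoute_append] at h ⊢
  exact ⟨h.1, h.2.start, by rw [ρ.act_one]; exact h.2⟩

theorem IsRoute.inv {x : X} {w : List G} (h : IsRoute ρ.act S x w) :
    IsRoute ρ.act S (ρ.act x w.prod) (w.map (·⁻¹)).reverse := by
  induction w generalizing x with
  | nil => simpa [ρ.act_one] using h
  | cons a w ih =>
    have h1 := ih h.2
    rw [← ρ.act_mul, ← List.prod_cons] at h1
    rw [List.map_cons, List.reverse_cons, isRoute_append, ρ.foldl_act,
      ← List.prod_inv_reverse]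
    refine ⟨h1, ?_⟩
    have e : ρ.act (ρ.act x (a :: w).prod) w.prod⁻¹ = ρ.act x a := by
      rw [← ρ.act_mul]; simp
    rw [e]
    refine ⟨h.2.start, ?_⟩
    rw [← ρ.act_mul]
    simpa [ρ.act_one, IsRoute] using h.1

theorem IsRoute.append_inv {x : X} {w : List G} (h : IsRoute ρ.act S x w) :
    IsRoute ρ.act S x (w ++ (w.map (·⁻¹)).reverse) := by
  rw [isRoute_append, ρ.foldl_act]
  exact ⟨h, h.inv⟩

variable (ρ S)

/-- The partial group `𝒫(S, X, G)` of parades in a non-empty subset `S` of the right `G`-set `X`. -/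
def paradeGroup (hS : S.Nonempty) : PartialGroup G where
  dom := {w | w ≠ [] ∧ ∃ x, IsRoute ρ.act S x w}
  mul := List.prod
  one := 1
  inv a := a⁻¹
  ne_nil h := h.1
  mul_singleton _ := List.prod_singleton
  tail_mem := by
    rintro a w ⟨-, x, h⟩ hw
    exact ⟨hw, _, h.2⟩
  init_mem := by
    rintro a w ⟨-, x, h⟩ hw
    exact ⟨hw, x, (isRoute_append.1 h).1⟩
  mul_mem := by
    rintro u v w ⟨-, x, h⟩ -
    exact ⟨by simp, x, h.mul⟩
  mul_mul _ _ := by simp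
  one_mem := by
    obtain ⟨x, hx⟩ := hS
    exact ⟨by simp, x, hx, by simpa [ρ.act_one, IsRoute] using hx⟩
  insert_one_mem := by
    rintro u v ⟨-, x, h⟩
    exact ⟨by simp, x, h.insert_one⟩
  one_mul _ := by simp
  mul_one _ := by simp
  append_inv_mem := by
    rintro w ⟨hw, x, h⟩
    exact ⟨by simp [hw], x, h.append_inv⟩
  inv_append_mem := by
    rintro w ⟨hw, x, h⟩
    refine ⟨by simp [hw], _, isRoute_append.2 ⟨h.inv, ?_⟩⟩
    rw [ρ.foldl_act, ← List.prod_inv_reverse, ← ρ.act_mul, mul_inv_cancel, ρ.act_one]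
    exact h
  mul_inv _ := by simp
  inv_mul _ := by simp

/-- The action of `𝒫(S, X, G)` on `S`. -/
def paradeSet (hS : S.Nonempty) : PSet (paradeGroup ρ S hS) S where
  dom := {p | IsRoute ρ.act S p.1 p.2}
  act x w := w.foldl ρ.act x
  nonempty := hS
  nil_mem := Iff.rfl
  act_nil _ := rfl
  fst_mem h := IsRoute.start h
  snd_mem {x w} h hw := ⟨hw, x, h⟩
  act_mem {x w} h := by
    have := IsRoute.end_mem h
    rwa [← ρ.foldl_act] at this
  init_mem h := (isRoute_append.1 h).1
  act_append_mem h := (isRoute_append.1 h).2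
  act_append _ := by simp
  mul_mem h _ := IsRoute.mul h
  act_mul _ _ := by simp [ρ.foldl_act, paradeGroup, ρ.act_mul]
  insert_one_mem h := IsRoute.insert_one h
  act_one _ := by simp [paradeGroup, ρ.act_one]
  append_inv_mem h := IsRoute.append_inv h

end Parades

section Wedge

variable {Λ G : Type*} [Group G]

/-- The ambient type `{1} ⊔ Λ × (G ∖ {1})` of the wedge sum of copies of `G`. -/
abbrev Wedge (Λ G : Type*) [Group G] : Type _ := Option (Λ × {g : G // g ≠ 1})

open Classical in
/-- The element `[l, a]`, which is `1` if `a = 1`. -/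
noncomputable def Wedge.mk (l : Λ) (a : G) : Wedge Λ G :=
  if h : a = 1 then none else some (l, ⟨a, h⟩)

/-- The `G`-component of an element. -/
def Wedge.val : Wedge Λ G → G
  | none => 1
  | some (_, a) => a

/-- The product of two elements with the same label (other pairs are never multiplied). -/
noncomputable def Wedge.mul₂ : Wedge Λ G → Wedge Λ G → Wedge Λ G
  | none, y => y
  | some (l, a), y => Wedge.mk l (a * y.val)

/-- The product of a word, `▽([l, a₁], …, [l, aₙ]) = [l, a₁ ⋯ aₙ]`. -/
noncomputable def Wedge.mul (w : List (Wedge Λ G)) : Wedge Λ G := w.foldr Wedge.mul₂ none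

/-- The inverse `[l, a]⁻¹ = [l, a⁻¹]`. -/
noncomputable def Wedge.inv : Wedge Λ G → Wedge Λ G
  | none => none
  | some (l, a) => Wedge.mk l (a : G)⁻¹

@[simp] theorem Wedge.mk_one (l : Λ) : Wedge.mk l (1 : G) = none := by simp [Wedge.mk]

@[simp] theorem Wedge.val_mk (l : Λ) (a : G) : (Wedge.mk l a).val = a := by
  unfold Wedge.mk
  split <;> simp_all [Wedge.val]

theorem Wedge.mk_ne_one (l : Λ) {a : G} (h : a ≠ 1) : Wedge.mk l a = some (l, ⟨a, h⟩) := by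
  simp [Wedge.mk, h]

@[simp] theorem Wedge.inv_mk (l : Λ) (a : G) : (Wedge.mk l a).inv = Wedge.mk l a⁻¹ := by
  by_cases h : a = 1
  · subst h; simp [Wedge.inv]
  · simp [Wedge.mk_ne_one l h, Wedge.inv]

@[simp] theorem Wedge.mul₂_mk (l : Λ) (a b : G) :
    (Wedge.mk l a).mul₂ (Wedge.mk l b) = Wedge.mk l (a * b) := by
  by_cases h : a = 1
  · subst h; simp [Wedge.mul₂]
  · rw [Wedge.mk_ne_one l h]; simp [Wedge.mul₂]

/-- The multiplication formula of the wedge sum. -/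
theorem Wedge.mul_map (l : Λ) (w : List G) :
    Wedge.mul (w.map (Wedge.mk l)) = Wedge.mk l w.prod := by
  induction w with
  | nil => simp [Wedge.mul]
  | cons a w ih =>
    have : Wedge.mul ((a :: w).map (Wedge.mk l)) =
      (Wedge.mk l a).mul₂ (Wedge.mul (w.map (Wedge.mk l))) := rfl
    rw [this, ih, Wedge.mul₂_mk, List.prod_cons]

theorem Wedge.map_invWord (l : Λ) (w : List G) :
    ((w.map (Wedge.mk l)).map Wedge.inv).reverse =
      ((w.map (·⁻¹)).reverse).map (Wedge.mk l) := by
  simp [List.map_reverse, Function.comp_def]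

/-- A word in the image of `[l, ·]`. -/
def Wedge.IsWord (l : Λ) (w : List (Wedge Λ G)) : Prop := ∃ as : List G, w = as.map (Wedge.mk l)

theorem Wedge.isWord_append {l : Λ} {u v : List (Wedge Λ G)} :
    Wedge.IsWord l (u ++ v) ↔ Wedge.IsWord l u ∧ Wedge.IsWord l v := by
  constructor
  · rintro ⟨as, h⟩
    obtain ⟨a, b, rfl, rfl, rfl⟩ := List.map_eq_append_iff.1 h.symm
    exact ⟨⟨a, rfl⟩, ⟨b, rfl⟩⟩
  · rintro ⟨⟨a, rfl⟩, ⟨b, rfl⟩⟩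
    exact ⟨a ++ b, by simp⟩

theorem Wedge.isWord_singleton {l : Λ} {x : Wedge Λ G} :
    Wedge.IsWord l [x] ↔ ∃ a : G, x = Wedge.mk l a := by
  constructor
  · rintro ⟨as, h⟩
    obtain ⟨a, b, rfl, rfl, hb⟩ := List.map_eq_cons_iff.1 h.symm
    exact ⟨a, rfl⟩
  · rintro ⟨a, rfl⟩
    exact ⟨[a], rfl⟩

theorem Wedge.isWord_cons {l : Λ} {x : Wedge Λ G} {w : List (Wedge Λ G)} :
    Wedge.IsWord l (x :: w) ↔ (∃ a : G, x = Wedge.mk l a) ∧ Wedge.IsWord l w := by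
  rw [← List.singleton_append, Wedge.isWord_append, Wedge.isWord_singleton]

theorem Wedge.isWord_mul {l : Λ} {u v w : List (Wedge Λ G)} (h : Wedge.IsWord l (u ++ v ++ w)) :
    Wedge.IsWord l (u ++ Wedge.mul v :: w) := by
  simp only [Wedge.isWord_append, Wedge.isWord_cons] at h ⊢
  obtain ⟨⟨hu, a, rfl⟩, hw⟩ := h
  exact ⟨hu, ⟨_, Wedge.mul_map l a⟩, hw⟩

theorem Wedge.isWord_one {l : Λ} {u v : List (Wedge Λ G)} (h : Wedge.IsWord l (u ++ v)) :
    Wedge.IsWord l (u ++ none :: v) := by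
  simp only [Wedge.isWord_append, Wedge.isWord_cons] at h ⊢
  exact ⟨h.1, ⟨1, by simp⟩, h.2⟩

theorem Wedge.isWord_inv {l : Λ} {w : List (Wedge Λ G)} (h : Wedge.IsWord l w) :
    Wedge.IsWord l (w.map Wedge.inv).reverse := by
  obtain ⟨a, rfl⟩ := h
  exact ⟨_, Wedge.map_invWord l a⟩

/-- The wedge sum `⋁_L G` of copies of the group `G` labelled by the non-empty set `L`. -/
noncomputable def wedge (G : Type*) [Group G] (L : Set Λ) (hL : L.Nonempty) :
    PartialGroup (Wedge Λ G) where
  dom := {w | w ≠ [] ∧ ∃ l ∈ L, ∃ as : List G, w = as.map (Wedge.mk l)}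
  mul := Wedge.mul
  one := none
  inv := Wedge.inv
  ne_nil h := h.1
  mul_singleton := by
    rintro x ⟨-, l, hl, h⟩
    obtain ⟨a, rfl⟩ := Wedge.isWord_singleton.1 h
    simpa using Wedge.mul_map l [a]
  tail_mem := by
    rintro x w ⟨-, l, hl, h⟩ hw
    exact ⟨hw, l, hl, (Wedge.isWord_cons.1 h).2⟩
  init_mem := by
    rintro x w ⟨-, l, hl, h⟩ hw
    exact ⟨hw, l, hl, (Wedge.isWord_append.1 h).1⟩
  mul_mem := by
    rintro u v w ⟨-, l, hl, h⟩ -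
    exact ⟨by simp, l, hl, Wedge.isWord_mul h⟩
  mul_mul := by
    rintro u v w ⟨-, l, hl, h⟩ -
    obtain ⟨h1, c, rfl⟩ := Wedge.isWord_append.1 h
    obtain ⟨⟨a, rfl⟩, b, rfl⟩ := Wedge.isWord_append.1 h1
    rw [Wedge.mul_map, ← List.map_cons, ← List.map_append, Wedge.mul_map, ← List.map_append,
      ← List.map_append, Wedge.mul_map]
    simp
  one_mem := by
    obtain ⟨l, hl⟩ := hL
    exact ⟨by simp, l, hl, [1], by simp⟩
  insert_one_mem := by
    rintro u v ⟨-, l, hl, h⟩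
    exact ⟨by simp, l, hl, Wedge.isWord_one h⟩
  one_mul := by
    rintro x ⟨-, l, hl, h⟩
    obtain ⟨a, rfl⟩ := Wedge.isWord_singleton.1 h
    simpa using Wedge.mul_map l [1, a]
  mul_one := by
    rintro x ⟨-, l, hl, h⟩
    obtain ⟨a, rfl⟩ := Wedge.isWord_singleton.1 h
    simpa using Wedge.mul_map l [a, 1]
  append_inv_mem := by
    rintro w ⟨hw, l, hl, h⟩
    exact ⟨by simp [hw], l, hl, Wedge.isWord_append.2 ⟨h, Wedge.isWord_inv h⟩⟩
  inv_append_mem := by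
    rintro w ⟨hw, l, hl, h⟩
    exact ⟨by simp [hw], l, hl, Wedge.isWord_append.2 ⟨Wedge.isWord_inv h, h⟩⟩
  mul_inv := by
    rintro x ⟨-, l, hl, h⟩
    obtain ⟨a, rfl⟩ := Wedge.isWord_singleton.1 h
    simpa using Wedge.mul_map l [a, a⁻¹]
  inv_mul := by
    rintro x ⟨-, l, hl, h⟩
    obtain ⟨a, rfl⟩ := Wedge.isWord_singleton.1 h
    simpa using Wedge.mul_map l [a⁻¹, a]

variable {α : Type*} {F : PartialGroup α} {L : Set Λ}

/-- `◁([x, a] | γ) = [◁(x | γ), a]`. -/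
def Wedge.act (S : PSet F L) : Wedge Λ G → List α → Wedge Λ G
  | none, _ => none
  | some (x, a), γ => some (S.act x γ, a)

@[simp] theorem Wedge.act_mk (S : PSet F L) (x : Λ) (a : G) (γ : List α) :
    (Wedge.mk x a).act S γ = Wedge.mk (S.act x γ) a := by
  by_cases h : a = 1
  · subst h; simp [Wedge.act]
  · simp [Wedge.mk_ne_one _ h, Wedge.act]

theorem Wedge.map_act (S : PSet F L) (x : Λ) (w : List G) (γ : List α) :
    (w.map (Wedge.mk x)).map (Wedge.act S · γ) = w.map (Wedge.mk (S.act x γ)) := by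
  simp [Function.comp_def]

variable (G)

/-- The pairs `([x, a₁], …, [x, aᵣ] | γ)` with `(x | γ) ∈ XFₙ` and `r ≥ 1`. -/
def wedgeActDom (S : PSet F L) : Set (List (Wedge Λ G) × List α) :=
  {p | p.1 ≠ [] ∧ ∃ x, (x, p.2) ∈ S.dom ∧ ∃ as : List G, p.1 = as.map (Wedge.mk x)}

/-- The `F`-set of words of the wedge sum. -/
noncomputable def wedgeWords (S : PSet F L) : PSet F (wedge G L S.nonempty).dom where
  dom := wedgeActDom G S
  act w γ := w.map (Wedge.act S · γ)
  nonempty := ⟨_, (wedge G L S.nonempty).one_mem⟩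
  nil_mem {w} := by
    constructor
    · rintro ⟨hw, x, hx, h⟩
      exact ⟨hw, x, S.nil_mem.1 hx, h⟩
    · rintro ⟨hw, x, hx, h⟩
      exact ⟨hw, x, S.nil_mem.2 hx, h⟩
  act_nil := by
    rintro w ⟨hw, x, hx, as, rfl⟩
    rw [Wedge.map_act, S.act_nil hx]
  fst_mem := by
    rintro w γ ⟨hw, x, hx, h⟩
    exact ⟨hw, x, S.fst_mem hx, h⟩
  snd_mem := by
    rintro w γ ⟨hw, x, hx, h⟩ hγ
    exact S.snd_mem hx hγ
  act_mem := by
    rintro w γ ⟨hw, x, hx, as, rfl⟩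
    exact ⟨by simpa using hw, _, S.act_mem hx, as, Wedge.map_act S x as γ⟩
  init_mem := by
    rintro w γ a ⟨hw, x, hx, h⟩
    exact ⟨hw, x, S.init_mem hx, h⟩
  act_append_mem := by
    rintro w u v ⟨hw, x, hx, as, rfl⟩
    exact ⟨by simpa using hw, _, S.act_append_mem hx, as, Wedge.map_act S x as u⟩
  act_append := by
    rintro w u v ⟨hw, x, hx, as, rfl⟩
    simp only [Wedge.map_act, S.act_append hx]
  mul_mem := by
    rintro w a b c ⟨hw, x, hx, h⟩ hb
    exact ⟨hw, x, S.mul_mem hx hb, h⟩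
  act_mul := by
    rintro w a b c ⟨hw, x, hx, as, rfl⟩ hb
    simp only [Wedge.map_act, S.act_mul hx hb]
  insert_one_mem := by
    rintro w u v ⟨hw, x, hx, h⟩
    exact ⟨hw, x, S.insert_one_mem hx, h⟩
  act_one := by
    rintro w ⟨hw, x, hx, as, rfl⟩
    rw [Wedge.map_act, S.act_one hx]
  append_inv_mem := by
    rintro w γ ⟨hw, x, hx, h⟩
    exact ⟨hw, x, S.append_inv_mem hx, h⟩

/-- The `F`-partial group `⋁_X G` given by a friendly `F`-set `X`. -/
noncomputable def wedgeAction (S : PSet F L) (hS : S.Friendly) :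
    FPartialGroup F (wedge G L S.nonempty) where
  words := wedgeWords G S
  letter := Wedge.act S
  act_eq _ := rfl
  tail_mem := by
    rintro a η γ ⟨-, x, hx, h⟩ hη
    exact ⟨hη, x, hx, (Wedge.isWord_cons.1 h).2⟩
  init_mem := by
    rintro a η γ ⟨-, x, hx, h⟩ hη
    exact ⟨hη, x, hx, (Wedge.isWord_append.1 h).1⟩
  mul_mem := by
    rintro u v w γ ⟨-, x, hx, h⟩ -
    exact ⟨by simp, x, hx, Wedge.isWord_mul h⟩
  letter_mul := by
    rintro u v w γ ⟨-, x, hx, h⟩ -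
    obtain ⟨as, rfl⟩ := (Wedge.isWord_append.1 (Wedge.isWord_append.1 h).1).2
    simp only [Wedge.map_act]
    change Wedge.act S (Wedge.mul _) _ = Wedge.mul _
    rw [Wedge.mul_map, Wedge.mul_map, Wedge.act_mk]
  insert_one_mem := by
    rintro u v γ ⟨-, x, hx, h⟩
    exact ⟨by simp, x, hx, Wedge.isWord_one h⟩
  one_mem {γ} h := by
    obtain ⟨x, hx⟩ := hS γ h
    exact ⟨by simp, x, hx, [1], by simp [wedge]⟩
  letter_one _ := rfl
  append_inv_mem := by
    rintro w γ ⟨hw, x, hx, h⟩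
    exact ⟨by simp [hw], x, hx, Wedge.isWord_append.2 ⟨h, Wedge.isWord_inv h⟩⟩
  inv_append_mem := by
    rintro w γ ⟨hw, x, hx, h⟩
    exact ⟨by simp [hw], x, hx, Wedge.isWord_append.2 ⟨Wedge.isWord_inv h, h⟩⟩
  letter_inv := by
    rintro a γ ⟨-, x, hx, h⟩
    obtain ⟨a, rfl⟩ := Wedge.isWord_singleton.1 h
    simp [wedge]

end Wedge

section Figures

/-- `ℝᵈ`. -/
abbrev Space (d : ℕ) : Type := EuclideanSpace ℝ (Fin d)

/-- The Euclidean group `E(d)`, acting on `ℝᵈ` from the right: in the product `a * b`, the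
isometry `a` is applied first. -/
abbrev Euclid (d : ℕ) : Type := (Space d ≃ᵢ Space d)ᵐᵒᵖ

variable {d : ℕ}

/-- The point `x a`. -/
noncomputable def Euclid.app (a : Euclid d) (x : Space d) : Space d := a.unop x

/-- The action of `E(d)` on the power set of `ℝᵈ`, `F a = {x a | x ∈ F}`. -/
noncomputable def figureAction (d : ℕ) : RightAction (Euclid d) (Set (Space d)) where
  act F a := a.app '' F
  act_one F := by simp [show (1 : Euclid d).app = id from rfl]
  act_mul F a b := by
    rw [Set.image_image]
    rfl

/-- The parallel translation `t_x : y ↦ x + y`. -/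
noncomputable def translation (x : Space d) : Euclid d := MulOpposite.op (IsometryEquiv.addLeft x)

/-- The orthogonal group `O(d)` as a subset of `E(d)`. -/
def orthogonal (d : ℕ) : Set (Euclid d) :=
  {a | ∃ L : Space d ≃ₗᵢ[ℝ] Space d, a = MulOpposite.op L.toIsometryEquiv}

/-- The symmetry group `G(F)`. -/
noncomputable def symGroup (F : Set (Space d)) : Subgroup (Euclid d) where
  carrier := {a | (figureAction d).act F a = F}
  one_mem' := (figureAction d).act_one F
  mul_mem' {a b} ha hb := by
    change (figureAction d).act F (a * b) = F
    rw [(figureAction d).act_mul, ha, hb]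
  inv_mem' {a} ha := by
    change (figureAction d).act F a⁻¹ = F
    conv_lhs => rw [← (show (figureAction d).act F a = F from ha)]
    rw [← (figureAction d).act_mul, mul_inv_cancel, (figureAction d).act_one]

/-- The set of connected components of `F`. -/
def cc (F : Set (Space d)) : Set (Set (Space d)) := {C | ∃ x ∈ F, C = connectedComponentIn F x}

theorem cc_nonempty {F : Set (Space d)} (hF : F.Nonempty) : (cc F).Nonempty :=
  hF.imp' (fun x => connectedComponentIn F x) fun x hx => ⟨x, hx, rfl⟩

/-- The symmetry partial group `𝒫(F)` of a non-empty figure. -/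
noncomputable def symPartialGroup (F : Set (Space d)) (hF : F.Nonempty) : PartialGroup (Euclid d) :=
  paradeGroup (figureAction d) (cc F) (cc_nonempty hF)

/-- The action of the vector group `ℝᵈ` (written multiplicatively) on `ℝᵈ`. -/
noncomputable def translationAction (d : ℕ) : RightAction (Multiplicative (Space d)) (Space d) where
  act x v := x + v.toAdd
  act_one x := by simp
  act_mul x v w := by simp [add_assoc]

/-- The partial group `𝒱(P)` of vector parades: its words are the sequences
`(P₁ - P₀, P₂ - P₁, …, Pₙ - Pₙ₋₁)` of vectors with `P₀, …, Pₙ ∈ P`, and `▽` is the sum. -/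
noncomputable def vectorParades (P : Set (Space d)) (hP : P.Nonempty) : PartialGroup (Space d) where
  dom := {w | w ≠ [] ∧ ∃ x, IsRoute (fun x v : Space d => x + v) P x w}
  mul := List.sum
  one := 0
  inv v := -v
  ne_nil h := (paradeGroup (translationAction d) P hP).ne_nil h
  mul_singleton h := (paradeGroup (translationAction d) P hP).mul_singleton h
  tail_mem h := (paradeGroup (translationAction d) P hP).tail_mem h
  init_mem h := (paradeGroup (translationAction d) P hP).init_mem h
  mul_mem h := (paradeGroup (translationAction d) P hP).mul_mem h
  mul_mul h := (paradeGroup (translationAction d) P hP).mul_mul h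
  one_mem := (paradeGroup (translationAction d) P hP).one_mem
  insert_one_mem h := (paradeGroup (translationAction d) P hP).insert_one_mem h
  one_mul h := (paradeGroup (translationAction d) P hP).one_mul h
  mul_one h := (paradeGroup (translationAction d) P hP).mul_one h
  append_inv_mem h := (paradeGroup (translationAction d) P hP).append_inv_mem h
  inv_append_mem h := (paradeGroup (translationAction d) P hP).inv_append_mem h
  mul_inv h := (paradeGroup (translationAction d) P hP).mul_inv h
  inv_mul h := (paradeGroup (translationAction d) P hP).inv_mul h

/-- The action of `𝒱(P)` on `P`, `◁(P₀ | P₁ - P₀, …, Pₙ - Pₙ₋₁) = Pₙ`. -/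
noncomputable def vectorSet (P : Set (Space d)) (hP : P.Nonempty) : PSet (vectorParades P hP) P where
  dom := {p | IsRoute (fun x v : Space d => x + v) P p.1 p.2}
  act x w := w.foldl (fun x v => x + v) x
  nonempty := hP
  nil_mem := (paradeSet (translationAction d) P hP).nil_mem
  act_nil h := (paradeSet (translationAction d) P hP).act_nil h
  fst_mem h := (paradeSet (translationAction d) P hP).fst_mem h
  snd_mem h := (paradeSet (translationAction d) P hP).snd_mem h
  act_mem h := (paradeSet (translationAction d) P hP).act_mem h
  init_mem h := (paradeSet (translationAction d) P hP).init_mem h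
  act_append_mem h := (paradeSet (translationAction d) P hP).act_append_mem h
  act_append h := (paradeSet (translationAction d) P hP).act_append h
  mul_mem h := (paradeSet (translationAction d) P hP).mul_mem h
  act_mul h := (paradeSet (translationAction d) P hP).act_mul h
  insert_one_mem h := (paradeSet (translationAction d) P hP).insert_one_mem h
  act_one h := (paradeSet (translationAction d) P hP).act_one h
  append_inv_mem h := (paradeSet (translationAction d) P hP).append_inv_mem h

theorem vectorSet_friendly (P : Set (Space d)) (hP : P.Nonempty) : (vectorSet P hP).Friendly :=
  fun _ h => h.2

/-- The semidirect product `𝒱(P) ⋉ ⋁_P G(F₀)`. -/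
noncomputable def figureSemidirect (F₀ P : Set (Space d)) (hP : P.Nonempty) :
    PartialGroup (Space d × Wedge (Space d) (symGroup F₀)) :=
  (wedgeAction (symGroup F₀) (vectorSet P hP) (vectorSet_friendly P hP)).semidirect

/-- The map `f : ⋁_P G(F₀) → 𝒫(F)`, `f([y, a]) = t_y⁻¹ a t_y`. -/
noncomputable def wedgeMap (F₀ : Set (Space d)) : Wedge (Space d) (symGroup F₀) → Euclid d
  | none => 1
  | some (y, a) => (translation y)⁻¹ * (a : symGroup F₀) * translation y

/-- The canonical map `ψ : 𝒱(P) ⋉ ⋁_P G(F₀) → 𝒫(F)`, `ψ(v ⋉ [y, a]) = t_v t_y⁻¹ a t_y`. -/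
noncomputable def sdMap (F₀ : Set (Space d)) (p : Space d × Wedge (Space d) (symGroup F₀)) : Euclid d :=
  translation p.1 * wedgeMap F₀ p.2

/-- For a figure `F` whose components are the translates `F₀ + x` (`x ∈ P`), with
`G(F₀) ≤ O(d)`: the canonical map `ψ` always induces an isomorphism from the quotient of
`𝒱(P) ⋉ ⋁_P G(F₀)` by the congruence `ψ(α) = ψ(β)` onto `𝒫(F)`. The figure is of SDP type if no
quotient is needed, that is, if `ψ` itself is an isomorphism of partial groups. -/
def IsSDPType (F F₀ P : Set (Space d)) (hF : F.Nonempty) (hP : P.Nonempty) : Prop :=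
  (figureSemidirect F₀ P hP).IsIso (symPartialGroup F hF) (sdMap F₀)

end Figures

end PartialSymmetry

open PartialSymmetry

namespace PartialSymmetry

/-! ### Isomorphisms of partial groups through injectivity and lifting of words -/

namespace PartialGroup

variable {α β : Type*} {P : PartialGroup α} {Q : PartialGroup β} {φ : α → β}

/-! An element of the semidirect product is best described by its start `x ∈ P`, its end `y ∈ P` and
some `a ∈ G(F₀)`: it is `(y - x) ⋉ [y, a]`, and `ψ` sends it to `t_x⁻¹ a t_y`, which carries the
component `F₀ + x` to `F₀ + y`. Every isometry between these two components has this form. More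
generally, a word of the semidirect product is a route in `P` decorated with elements of `G(F₀)`
(`exists_liftWord`, `liftWord_mem`), and a parade of components lifts to such a route
(`exists_lift_of_isRoute`). So `ψ` is always a map of partial groups that is surjective on words,
and being of SDP type comes down to injectivity of `ψ` on elements (`IsMap.isIso`, `IsIso.injOn`).

The only identification in the source is that `[y, 1]` does not remember `y` (`Wedge.mk_inj`). In
the target, `t_x⁻¹ a t_y = t_{x'}⁻¹ a' t_{y'}` forces `a = a'` and `y - y' = (x - x')a`
(`eq_of_sdMap_eq`). Under the assumptions of the second statement, `|y - y'| = |x - x'|` gives `(x -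
x')a = ±(x - x')`, so either `x = x'` and `y = y'`, or `a = 1` and `y - x = y' - x'`; in both cases
the two elements coincide.

For the first statement, a symmetry `g` of `F` permutes the components, so each point of `P` is the
start of some element lying over `g`. Two different starts give two lifts. If these were equal,
either `a = 1` and `g` is a translation, or the ends agree and then so do the starts. -/

theorem IsIso.injOn (h : P.IsIso Q φ) : Set.InjOn φ P.carrier := by
  obtain ⟨-, χ, -, h1, -⟩ := h
  intro a ha b hb e
  rw [← h1 a ha, ← h1 b hb, e]

theorem mul_carrier {w : List α} (h : w ∈ P.dom) : P.mul w ∈ P.carrier := by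
  simpa [carrier] using P.mul_mem (u := []) (v := w) (w := []) (by simpa using h) (P.ne_nil h)

/-- A map of partial groups that is injective on elements and surjective on words is an
isomorphism. -/
theorem IsMap.isIso (h : P.IsMap Q φ) (hinj : Set.InjOn φ P.carrier)
    (hsurj : ∀ w ∈ Q.dom, ∃ u ∈ P.dom, u.map φ = w) : P.IsIso Q φ := by
  -- Only supplies the default value of `Function.invFunOn`, which is never reached on `Q.carrier`.
  have : Nonempty α := ⟨P.one⟩
  have hleft : ∀ a ∈ P.carrier, Function.invFunOn φ P.carrier (φ a) = a := fun a ha =>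
    hinj (Function.invFunOn_mem ⟨a, ha, rfl⟩) ha (Function.invFunOn_eq ⟨a, ha, rfl⟩)
  refine ⟨h, Function.invFunOn φ P.carrier, fun w hw => ?_, hleft, fun b hb => ?_⟩
  -- Surjectivity on words is what makes the inverse a map: applied letterwise, it returns the
  -- chosen preimage `u`, which is known to be a word.
  · obtain ⟨u, hu, rfl⟩ := hsurj w hw
    have e : (u.map φ).map (Function.invFunOn φ P.carrier) = u := by
      rw [List.map_map]
      conv_rhs => rw [← List.map_id u]
      exact List.map_congr_left fun a ha => hleft a (letter_mem hu ha)
    rw [e, (h u hu).2]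
    exact ⟨hu, (hleft _ (mul_carrier hu)).symm⟩
  · obtain ⟨u, hu, e⟩ := hsurj [b] hb
    obtain ⟨a, rfl, rfl⟩ := List.map_eq_singleton_iff.1 e
    exact Function.invFunOn_eq ⟨a, hu, rfl⟩

end PartialGroup

/-- The label is forgotten only at the unit. This dichotomy is the case split behind both halves of
the proposition. -/
theorem Wedge.mk_inj {Λ G : Type*} [Group G] {x y : Λ} {a b : G} :
    Wedge.mk x a = Wedge.mk y b ↔ a = b ∧ (a = 1 ∨ x = y) := by
  by_cases ha : a = 1
  · subst ha
    by_cases hb : b = 1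
    · simp [hb]
    · simp [Wedge.mk_ne_one _ hb, Ne.symm hb]
  · by_cases hb : b = 1
    · simp [hb, Wedge.mk_ne_one _ ha, ha]
    · simp [Wedge.mk_ne_one _ hb, Wedge.mk_ne_one _ ha, ha, and_comm]

/-! ### Words lifted from decorated routes -/

variable {d : ℕ}

/-- The word `(v₁ ⋉ [x + v₁, a₁], v₂ ⋉ [x + v₁ + v₂, a₂], …)`. -/
noncomputable def liftWord {G : Type*} [Group G] :
    Space d → List (Space d × G) → List (Space d × Wedge (Space d) G)
  | _, [] => []
  | x, p :: l => (p.1, Wedge.mk (x + p.1) p.2) :: liftWord (x + p.1) l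

theorem map_fst_liftWord {G : Type*} [Group G] (x : Space d) (l : List (Space d × G)) :
    (liftWord x l).map Prod.fst = l.map Prod.fst := by
  induction l generalizing x with
  | nil => rfl
  | cons p l ih => simp [liftWord, ih]

theorem foldl_add_eq (x : Space d) (w : List (Space d)) :
    w.foldl (fun x v => x + v) x = x + w.sum := by
  induction w generalizing x with
  | nil => simp
  | cons v w ih => rw [List.foldl_cons, ih, List.sum_cons, add_assoc]

/-! ### Words of the semidirect product as decorated routes in `P` -/

section Semidirect

variable {F₀ P : Set (Space d)} {hP : P.Nonempty}

/-- A route can be travelled backwards from its end; this is the inverse-word axiom of the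
`𝒱(P)`-set `P`. -/
theorem isRoute_neg {x : Space d} {w : List (Space d)}
    (h : IsRoute (fun x v : Space d => x + v) P x w) :
    IsRoute (fun x v : Space d => x + v) P (x + w.sum) (w.map (- ·)).reverse := by
  have h1 : (x, w) ∈ (vectorSet P ⟨x, h.start⟩).dom := h
  have h2 : IsRoute (fun x v : Space d => x + v) P (w.foldl (fun x v => x + v) x)
    (w.map (- ·)).reverse := PSet.act_inv_mem h1
  rwa [foldl_add_eq] at h2

/-- Membership in the semidirect product is tested on the backward route from the final label.
Reversing once more recovers the forward route, whose start is the end minus the total displacement.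
-/
theorem isRoute_of_neg {x : Space d} {w : List (Space d)}
    (h : IsRoute (fun x v : Space d => x + v) P x (w.map (- ·)).reverse) :
    IsRoute (fun x v : Space d => x + v) P (x - w.sum) w := by
  have h1 := isRoute_neg h
  have e : (w.map (- ·)).sum = -w.sum := (List.sum_neg w).symm
  rw [List.sum_reverse, e, ← sub_eq_add_neg] at h1
  simpa [List.map_reverse, Function.comp_def] using h1

/-- The `𝒱(P)`-partial group `⋁_P G(F₀)`. -/
noncomputable abbrev figureWedge (F₀ P : Set (Space d)) (hP : P.Nonempty) :
    FPartialGroup (vectorParades P hP) (wedge (symGroup F₀) P (vectorSet P hP).nonempty) :=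
  wedgeAction (symGroup F₀) (vectorSet P hP) (vectorSet_friendly P hP)

theorem letter_mk (x : Space d) (a : symGroup F₀) (w : List (Space d)) :
    (figureWedge F₀ P hP).letter (Wedge.mk x a) w = Wedge.mk (x + w.sum) a := by
  rw [← foldl_add_eq]
  exact Wedge.act_mk _ x a w

/-- Each letter is labelled by the point reached just after it, and the twist transports that label
along the remaining vectors. All labels therefore arrive at the end of the route, which makes the
twisted word a word of the wedge sum. -/
theorem twist_liftWord (x : Space d) (l : List (Space d × symGroup F₀)) :
    (figureWedge F₀ P hP).twist (liftWord x l) =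
      (l.map Prod.snd).map (Wedge.mk (x + (l.map Prod.fst).sum)) := by
  induction l generalizing x with
  | nil => rfl
  | cons p l ih =>
    simp only [liftWord, FPartialGroup.twist, ih, map_fst_liftWord, letter_mk, List.map_cons,
      List.sum_cons, add_assoc]

/-- The rest of the route starts at the label of the current letter, hence can act on it. -/
theorem comp_liftWord {x : Space d} {l : List (Space d × symGroup F₀)}
    (h : IsRoute (fun x v : Space d => x + v) P x (l.map Prod.fst)) :
    (figureWedge F₀ P hP).Comp (liftWord x l) := by
  induction l generalizing x with
  | nil => exact FPartialGroup.Comp.nil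
  | cons p l ih =>
    refine FPartialGroup.Comp.cons_iff.2 ⟨⟨by simp, x + p.1, ?_, [p.2], rfl⟩, ih h.2⟩
    rw [map_fst_liftWord]
    exact h.2

theorem letters_liftWord {x : Space d} {l : List (Space d × symGroup F₀)}
    (h : IsRoute (fun x v : Space d => x + v) P x (l.map Prod.fst)) :
    ∀ a ∈ liftWord x l, ∃ δ, a.1 = -δ ∧ δ ∈ (vectorParades P hP).carrier ∧
      ([a.2], [δ]) ∈ (figureWedge F₀ P hP).words.dom := by
  induction l generalizing x with
  | nil => simp [liftWord]
  | cons p l ih =>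
    intro a ha
    rcases List.mem_cons.1 ha with rfl | ha
    -- The vector acting on the label `x + v` is `-v`, the step back to `x`.
    · have hr : IsRoute (fun x v : Space d => x + v) P (x + p.1) [-p.1] :=
        ⟨h.2.start, by simpa [IsRoute] using h.1⟩
      exact ⟨-p.1, by simp, ⟨by simp, _, hr⟩, by simp, _, hr, [p.2], rfl⟩
    · exact ih h.2 a ha

theorem liftWord_mem {x : Space d} {l : List (Space d × symGroup F₀)} (hl : l ≠ [])
    (h : IsRoute (fun x v : Space d => x + v) P x (l.map Prod.fst)) :
    liftWord x l ∈ (figureSemidirect F₀ P hP).dom := by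
  refine ⟨?_, letters_liftWord h, comp_liftWord h, ?_⟩
  · cases l with
    | nil => exact absurd rfl hl
    | cons p l => simp [liftWord]
  · rw [twist_liftWord, map_fst_liftWord]
    exact ⟨by simpa using hl, _, isRoute_neg h, _, rfl⟩

/-- The common label `z` of the twisted word is the end of the route, so the start has to be `z`
minus the sum of all vectors. Undoing the transport then determines the label of each letter, except
at units, where it can be chosen freely. -/
theorem eq_liftWord {w : List (Space d × Wedge (Space d) (symGroup F₀))} {z : Space d}
    {as : List (symGroup F₀)} (hc : (figureWedge F₀ P hP).Comp w)
    (h : (figureWedge F₀ P hP).twist w = as.map (Wedge.mk z)) :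
    ∃ l, w = liftWord (z - (w.map Prod.fst).sum) l := by
  induction w generalizing as with
  | nil => exact ⟨[], rfl⟩
  | cons p w ih =>
    obtain ⟨v, η⟩ := p
    obtain ⟨⟨-, y, -, h1⟩, hc'⟩ := FPartialGroup.Comp.cons_iff.1 hc
    obtain ⟨b, rfl⟩ := Wedge.isWord_singleton.1 h1
    obtain ⟨a, as', rfl, ha, h'⟩ := List.map_eq_cons_iff.1 h.symm
    obtain ⟨l, hl⟩ := ih hc' h'.symm
    -- Transported along the tail, the label `y` of the head must become `z` unless the letter is
    -- the unit.
    rw [letter_mk, Wedge.mk_inj] at ha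
    obtain ⟨rfl, ha⟩ := ha
    refine ⟨(v, a) :: l, ?_⟩
    -- After the first step the route is at the start that the induction hypothesis gives for the
    -- tail.
    have e : z - (((v, Wedge.mk y a) :: w).map Prod.fst).sum + v = z - (w.map Prod.fst).sum := by
      simp only [List.map_cons, List.sum_cons]
      abel
    rw [liftWord, e, ← hl]
    congr 2
    rw [Wedge.mk_inj]
    exact ⟨rfl, ha.imp_right fun ha => by simp [ha]⟩

/-- The words of `𝒱(P) ⋉ ⋁_P G(F₀)` are the lifts of the routes in `P`. -/
theorem exists_liftWord {w : List (Space d × Wedge (Space d) (symGroup F₀))}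
    (h : w ∈ (figureSemidirect F₀ P hP).dom) :
    ∃ x l, IsRoute (fun x v : Space d => x + v) P x (l.map Prod.fst) ∧ w = liftWord x l := by
  obtain ⟨-, -, hc, -, z, hz, as, e⟩ := h
  obtain ⟨l, hl⟩ := eq_liftWord hc e
  refine ⟨_, l, ?_, hl⟩
  have h1 := isRoute_of_neg hz
  have e1 : l.map Prod.fst = w.map Prod.fst := by
    conv_rhs => rw [hl]
    rw [map_fst_liftWord]
  rwa [e1]

/-- The one-letter case of `exists_liftWord`. The triple `(x, y, a)` is a convenient description,
but for `a = 1` only `y - x` is determined. -/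
theorem exists_of_mem_carrier {p : Space d × Wedge (Space d) (symGroup F₀)}
    (h : p ∈ (figureSemidirect F₀ P hP).carrier) :
    ∃ x ∈ P, ∃ y ∈ P, ∃ a, p = (y - x, Wedge.mk y a) := by
  obtain ⟨x, l, hr, e⟩ := exists_liftWord h
  cases l with
  | nil => simp [liftWord] at e
  | cons q l =>
    refine ⟨x, hr.1, x + q.1, hr.2.start, q.2, ?_⟩
    simp only [liftWord, List.cons.injEq] at e
    rw [e.1, add_sub_cancel_left]

theorem pair_mem_carrier {x y : Space d} (hx : x ∈ P) (hy : y ∈ P) (a : symGroup F₀) :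
    (y - x, Wedge.mk y a) ∈ (figureSemidirect F₀ P hP).carrier := by
  have := liftWord_mem (hP := hP) (x := x) (l := [(y - x, a)]) (by simp)
    ⟨hx, by simpa [IsRoute] using hy⟩
  simpa [liftWord, PartialGroup.carrier] using this

theorem sub_mem_vectorParades {x y : Space d} (hx : x ∈ P) (hy : y ∈ P) :
    x - y ∈ (vectorParades P hP).carrier :=
  ⟨by simp, y, hy, by simpa [IsRoute] using hx⟩

/-! ### The values of `ψ` and the isometries between components -/

theorem wedgeMap_mk (y : Space d) (a : symGroup F₀) :
    wedgeMap F₀ (Wedge.mk y a) = (translation y)⁻¹ * (a : Euclid d) * translation y := by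
  by_cases h : a = 1
  · subst h; simp [wedgeMap]
  · rw [Wedge.mk_ne_one _ h]; rfl

theorem translation_add (x y : Space d) :
    translation (x + y) = translation x * translation y := by
  refine MulOpposite.unop_injective (IsometryEquiv.ext fun z => ?_)
  change x + y + z = y + (x + z)
  abel

/-- Since `t_{x+v} = t_x t_v`, the product `t_v t_{x+v}⁻¹` collapses to `t_x⁻¹`. The value becomes:
move back to `F₀`, apply `a`, move on to the target. -/
theorem sdMap_mk (x v : Space d) (a : symGroup F₀) :
    sdMap F₀ (v, Wedge.mk (x + v) a) =
      (translation x)⁻¹ * (a : Euclid d) * translation (x + v) := by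
  simp only [sdMap, wedgeMap_mk]
  rw [translation_add]
  group

theorem sdMap_sub_mk (x y : Space d) (a : symGroup F₀) :
    sdMap F₀ (y - x, Wedge.mk y a) =
      (translation x)⁻¹ * (a : Euclid d) * translation y := by
  simpa using sdMap_mk x (y - x) a

/-- The product telescopes: the translation ending one factor cancels against the inverse
translation opening the next. -/
theorem prod_map_sdMap (x : Space d) (l : List (Space d × symGroup F₀)) :
    ((liftWord x l).map (sdMap F₀)).prod = (translation x)⁻¹ *
      ((l.map Prod.snd).prod : Euclid d) * translation (x + (l.map Prod.fst).sum) := by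
  induction l generalizing x with
  | nil => simp [liftWord]
  | cons p l ih =>
    simp only [liftWord, List.map_cons, List.prod_cons, ih, sdMap_mk, List.sum_cons, add_assoc,
      Subgroup.coe_mul]
    group

theorem act_translation (F : Set (Space d)) (x : Space d) :
    (figureAction d).act F (translation x) = (fun y => y + x) '' F := by
  change (fun y => x + y) '' F = _
  simp only [add_comm]

theorem act_translation_add (x v : Space d) (a : symGroup F₀) :
    (figureAction d).act ((fun y => y + x) '' F₀)
        ((translation x)⁻¹ * (a : Euclid d) * translation (x + v)) =
      (fun y => y + (x + v)) '' F₀ := by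
  rw [← act_translation, ← (figureAction d).act_mul, ← mul_assoc, mul_inv_cancel_left,
    (figureAction d).act_mul, show (figureAction d).act F₀ a = F₀ from a.2, act_translation]

/-- Moving both ends back to `F₀` turns `g` into `t_x g t_y⁻¹`, which stabilises `F₀`. This is the
source of surjectivity. -/
theorem exists_of_act_eq {x y : Space d} {g : Euclid d}
    (h : (figureAction d).act ((fun y => y + x) '' F₀) g = (fun z => z + y) '' F₀) :
    ∃ a : symGroup F₀, g = (translation x)⁻¹ * (a : Euclid d) * translation y := by
  refine ⟨⟨translation x * g * (translation y)⁻¹, ?_⟩, by group⟩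
  change (figureAction d).act F₀ _ = F₀
  rw [(figureAction d).act_mul, (figureAction d).act_mul, act_translation, h, ← act_translation,
    ← (figureAction d).act_mul, mul_inv_cancel, (figureAction d).act_one]

/-! ### `ψ` is a map of partial groups and surjective on words -/

variable {F : Set (Space d)} {hF : F.Nonempty}

theorem isRoute_map_sdMap (hcc : cc F = {C | ∃ x ∈ P, C = (fun y => y + x) '' F₀})
    {x : Space d} {l : List (Space d × symGroup F₀)}
    (h : IsRoute (fun x v : Space d => x + v) P x (l.map Prod.fst)) :
    IsRoute (figureAction d).act (cc F) ((fun y => y + x) '' F₀)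
      ((liftWord x l).map (sdMap F₀)) := by
  induction l generalizing x with
  | nil => exact hcc ▸ ⟨x, h, rfl⟩
  | cons p l ih =>
    refine ⟨hcc ▸ ⟨x, h.1, rfl⟩, ?_⟩
    have := ih h.2
    rwa [← act_translation_add x p.1 p.2, ← sdMap_mk] at this

theorem isMap_sdMap (hcc : cc F = {C | ∃ x ∈ P, C = (fun y => y + x) '' F₀}) :
    (figureSemidirect F₀ P hP).IsMap (symPartialGroup F hF) (sdMap F₀) := by
  intro w hw
  have hne := hw.1
  obtain ⟨x, l, h, rfl⟩ := exists_liftWord hw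
  refine ⟨⟨by simpa using hne, _, isRoute_map_sdMap hcc h⟩, ?_⟩
  change ((liftWord x l).map (sdMap F₀)).prod = sdMap F₀ (((liftWord x l).map Prod.fst).sum,
    Wedge.mul ((figureWedge F₀ P hP).twist (liftWord x l)))
  -- Both sides become `t_x⁻¹ (a₁ ⋯ aₙ) t_z`, with `z` the end of the route.
  rw [twist_liftWord, Wedge.mul_map, map_fst_liftWord, sdMap_mk, prod_map_sdMap]

/-- The component reached by the first letter is `F₀ + y` for some `y ∈ P`. Any such `y` serves as
the next point of the route, and the lifting continues from there. -/
theorem exists_lift_of_isRoute (hcc : cc F = {C | ∃ x ∈ P, C = (fun y => y + x) '' F₀})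
    {x : Space d} (hx : x ∈ P) {w : List (Euclid d)}
    (h : IsRoute (figureAction d).act (cc F) ((fun y => y + x) '' F₀) w) :
    ∃ l : List (Space d × symGroup F₀),
      IsRoute (fun x v : Space d => x + v) P x (l.map Prod.fst) ∧
        (liftWord x l).map (sdMap F₀) = w := by
  induction w generalizing x with
  | nil => exact ⟨[], hx, rfl⟩
  | cons g w ih =>
    have h2 := h.2
    obtain ⟨y, hy, e⟩ := hcc ▸ h2.start
    rw [e] at h2
    obtain ⟨l, hl, rfl⟩ := ih hy h2
    obtain ⟨a, rfl⟩ := exists_of_act_eq e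
    refine ⟨(y - x, a) :: l, ⟨hx, by simpa using hl⟩, ?_⟩
    simp only [liftWord, List.map_cons, add_sub_cancel, sdMap_sub_mk]

theorem exists_map_sdMap (hcc : cc F = {C | ∃ x ∈ P, C = (fun y => y + x) '' F₀})
    {w : List (Euclid d)} (h : w ∈ (symPartialGroup F hF).dom) :
    ∃ u ∈ (figureSemidirect F₀ P hP).dom, u.map (sdMap F₀) = w := by
  obtain ⟨hne, C, hC⟩ := h
  obtain ⟨x, hx, rfl⟩ := hcc ▸ hC.start
  obtain ⟨l, hl, e⟩ := exists_lift_of_isRoute hcc hx hC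
  refine ⟨_, liftWord_mem ?_ hl, e⟩
  rintro rfl
  exact hne e.symm

/-! ### Injectivity of `ψ` and its failure -/

theorem act_mem_cc {g : Euclid d} (hg : g ∈ symGroup F) {C : Set (Space d)} (hC : C ∈ cc F) :
    (figureAction d).act C g ∈ cc F := by
  obtain ⟨x, hx, rfl⟩ := hC
  have hg' : g.unop '' F = F := hg
  refine ⟨g.unop x, hg' ▸ ⟨x, hx, rfl⟩, ?_⟩
  have := g.unop.toHomeomorph.image_connectedComponentIn hx
  exact this.trans (by rw [show g.unop.toHomeomorph '' F = F from hg']; rfl)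

/-- As `G(F₀)` consists of linear isometries, each side is an affine map `z ↦ y + L(z - x)`.
Comparing linear parts and constant terms gives the two conclusions. -/
theorem eq_of_sdMap_eq (hO : (symGroup F₀ : Set (Euclid d)) ⊆ orthogonal d)
    {x y x' y' : Space d} {a a' : symGroup F₀}
    (h : (translation x)⁻¹ * (a : Euclid d) * translation y =
      (translation x')⁻¹ * (a' : Euclid d) * translation y') :
    a = a' ∧ y - y' = Euclid.app a (x - x') := by
  obtain ⟨L, hL⟩ := hO a.2
  obtain ⟨L', hL'⟩ := hO a'.2
  have key : ∀ z, y + L (-x + z) = y' + L' (-x' + z) := fun z => by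
    have := congrArg (fun g : Euclid d => g.app z) h
    rw [hL, hL'] at this
    exact this
  -- The value at `0` is the constant term; cancelling it leaves `L z = L' z`.
  have e0 := key 0
  have eL : L = L' := by
    ext1 z
    have ez := key z
    simp only [map_add, add_zero] at ez e0
    rw [← add_assoc, ← add_assoc, e0] at ez
    exact add_left_cancel ez
  subst eL
  refine ⟨Subtype.ext (hL.trans hL'.symm), ?_⟩
  rw [hL]
  change y - y' = L (x - x')
  simp only [map_neg, add_zero] at e0
  rw [map_sub, sub_eq_sub_iff_add_eq_add]
  have := congrArg (· + L x + L x') e0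
  simp only [neg_add_cancel_right] at this
  rw [add_right_comm, neg_add_cancel_right] at this
  rw [this, add_comm]

theorem norm_app (hO : (symGroup F₀ : Set (Euclid d)) ⊆ orthogonal d) (a : symGroup F₀)
    (v : Space d) : ‖Euclid.app a v‖ = ‖v‖ := by
  obtain ⟨L, hL⟩ := hO a.2
  rw [hL]
  exact L.norm_map v

/-- The assumptions are applied to the differences `x - x'` of the starts and `y - y'` of the ends,
not to the vector components of the two elements. -/
theorem sdMap_injOn (hO : (symGroup F₀ : Set (Euclid d)) ⊆ orthogonal d)
    (hnorm : ∀ v ∈ (vectorParades P hP).carrier, ∀ w ∈ (vectorParades P hP).carrier,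
      ‖v‖ = ‖w‖ → v = w ∨ v = -w)
    (hfix : ∀ v ∈ (vectorParades P hP).carrier, ∀ a ∈ symGroup F₀,
      a.app v = v ∨ a.app v = -v → v = 0 ∨ a = 1) :
    Set.InjOn (sdMap F₀) (figureSemidirect F₀ P hP).carrier := by
  intro p hp q hq h
  obtain ⟨x, hx, y, hy, a, rfl⟩ := exists_of_mem_carrier hp
  obtain ⟨x', hx', y', hy', a', rfl⟩ := exists_of_mem_carrier hq
  rw [sdMap_sub_mk, sdMap_sub_mk] at h
  obtain ⟨rfl, e⟩ := eq_of_sdMap_eq hO h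
  have hv := sub_mem_vectorParades (hP := hP) hx hx'
  -- Since `y - y'` is the image of `x - x'` under the orthogonal map `a`, the norms agree;
  -- rewriting by `e` then gives exactly the premise of `hfix`.
  have h1 := hnorm _ (sub_mem_vectorParades hy hy') _ hv (by rw [e, norm_app hO])
  rw [e] at h1
  rcases hfix _ hv a a.2 h1 with h0 | h0
  · rw [h0] at e
    have h2 : Euclid.app a (0 : Space d) = 0 := by simpa using norm_app hO a 0
    rw [h2] at e
    rw [sub_eq_zero.1 h0, sub_eq_zero.1 e]
  -- With `a = 1` the labels disappear, so only the displacements `y - x` and `y' - x'` have to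
  -- agree.
  · have ha : a = 1 := Subtype.ext h0
    subst ha
    have e' : y - y' = x - x' := e
    rw [Wedge.mk_one, Wedge.mk_one, sub_eq_sub_iff_sub_eq_sub.1 e']

/-- A global symmetry acts on every component, so it has one lift starting at `x` and another
starting at `x'`. Injectivity would identify them. -/
theorem not_isSDPType (hcc : cc F = {C | ∃ x ∈ P, C = (fun y => y + x) '' F₀})
    (hcard : P.Nontrivial)
    {g : Euclid d} (hg : g ∈ symGroup F) (ht : ∀ x, g ≠ translation x) :
    ¬ IsSDPType F F₀ P hF hP := by
  intro h
  obtain ⟨x, hx, x', hx', hne⟩ := hcard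
  have hstep : ∀ x ∈ P, ∃ y ∈ P,
      (figureAction d).act ((fun y => y + x) '' F₀) g = (fun z => z + y) '' F₀ := fun x hx => by
    have := act_mem_cc hg (C := (fun y => y + x) '' F₀) (hcc ▸ ⟨x, hx, rfl⟩)
    rwa [hcc] at this
  obtain ⟨y, hy, e⟩ := hstep x hx
  obtain ⟨y', hy', e'⟩ := hstep x' hx'
  obtain ⟨a, ha⟩ := exists_of_act_eq e
  obtain ⟨a', ha'⟩ := exists_of_act_eq e'
  have hs := (sdMap_sub_mk x y a).trans ha.symm
  have hs' := (sdMap_sub_mk x' y' a').trans ha'.symm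
  have hp := h.injOn (pair_mem_carrier hx hy a) (pair_mem_carrier hx' hy' a') (hs.trans hs'.symm)
  obtain ⟨h1, h2⟩ := Prod.ext_iff.1 hp
  -- Equal wedge components leave two cases: `a = 1`, where `g` is the translation by `y - x`, or
  -- equal ends, where equality of the vectors forces `x = x'`.
  rcases (Wedge.mk_inj.1 h2).2 with rfl | rfl
  · refine ht (y - x) ?_
    rw [← hs, Wedge.mk_one]
    simp [sdMap, wedgeMap]
  · exact hne (sub_right_injective h1)

end Semidirect

end PartialSymmetry

open PartialSymmetry
theorem proposition12p4 {d : ℕ} (F F₀ P : Set (Space d)) (hF : F.Nonempty) (hP : P.Nonempty)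
    (hcc : cc F = {C | ∃ x ∈ P, C = (fun y => y + x) '' F₀})
    (hO : (symGroup F₀ : Set (Euclid d)) ⊆ orthogonal d) :
    (2 ≤ P.encard →
      ¬ (symGroup F : Set (Euclid d)) ⊆ {g | ∃ x : Space d, g = translation x} →
      ¬ IsSDPType F F₀ P hF hP) ∧
    ((∀ v ∈ (vectorParades P hP).carrier, ∀ w ∈ (vectorParades P hP).carrier,
        ‖v‖ = ‖w‖ → v = w ∨ v = -w) →
      (∀ v ∈ (vectorParades P hP).carrier, ∀ a ∈ symGroup F₀,
        a.app v = v ∨ a.app v = -v → v = 0 ∨ a = 1) →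
      IsSDPType F F₀ P hF hP) := by
  refine ⟨fun hcard hg => ?_, fun hnorm hfix => ?_⟩
  · obtain ⟨g, hg, ht⟩ := Set.not_subset.1 hg
    refine not_isSDPType hcc ?_ hg fun x hx => ht ⟨x, hx⟩
    refine Set.one_lt_encard_iff_nontrivial.1 (lt_of_lt_of_le ?_ hcard)
    norm_num
  · exact (isMap_sdMap hcc).isIso (sdMap_injOn hO hnorm hfix) fun w hw => exists_map_sdMap hcc hw
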